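/- Let $k$ be a field of characteristic zero, $A$ a commutative $k$-algebra, $I$ a free $A$-module of finite rank, and $0\to I\to B\xrightarrow{\pi}A\to 0$ an extension of commutative $k$-algebras with $I^2=0$, split by a $k$-algebra morphism $\sigma\colon A\to B$. Complexes are graded homologically and unadorned tensor products are over $A$. For a complex $K$ of $B$-modules put $\overline K=K\otimes_BA$, let $\mathrm{Tor}^1_B(K,A)$ be the complex of $A$-modules obtained by applying the first left derived functor of $-\otimes_BA$ termwise, and let $\mu_K\colon I\otimes\overline K\to K$ be the multiplication map. The complex $K$ is called admissible if the complex $\mathrm{Tor}^1_B(K,A)$ is acyclic. Let $\mathrm D^{\mathrm{adm}}(B)$ be the localization of the homotopy category $\mathrm K^-(B)$ with respect to the null system of those complexes $K$ for which both $\overline K$ and $\mathrm{Tor}^1_B(K,A)$ are exact; $K\mapsto\overline K$ induces a functor $\mathrm D^{\mathrm{adm}}(B)\to\mathrm D^-(A)$. Viewing $K$ as a complex of $A$-modules via $\sigma$, the local HKR class $\theta_K\colon\overline K\to\mathrm{Tor}^1_B(K,A)[2]$ is the morphism in the derived category of $A$ associated with the exact sequence $$0\to\mathrm{Tor}^1_B(K,A)\to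 I\otimes\overline K\xrightarrow{\mu_K}K\to\overline K\to0 .$$ Let $N$ be an integer and let $K$ be a bounded complex of $B$-modules concentrated in homological degrees $\ge N$. Then the following are equivalent: (i) $\theta_K=0$. (ii) The canonical morphism $K\otimes^{\mathbf L}_BA\to K\otimes_BA$ admits a right inverse in $\mathrm D^-(A)$. (iii) There exist a bounded admissible complex $V$ of $B$-modules concentrated in degrees $\ge N$ and a morphism $V\to K$ in $\mathrm D^{\mathrm b}(B)$ such that the composite $V\otimes^{\mathbf L}_BA\to K\otimes^{\mathbf L}_BA\to K\otimes_BA$ is an isomorphism in $\mathrm D^-(A)$. (iv) There exist a bounded admissible complex $V$ of $B$-modules concentrated in degrees $\ge N$ and a morphism $V\to K$ in $\mathrm D^{\mathrm{adm}}(B)$ such that the induced morphism $\overline V\to\overline K$ is an isomorphism in $\mathrm D^{\mathrm b}(A)$. (v) There exist a bounded admissible complex $V$ of $B$-modules concentrated in degrees $\ge N$ and a subcomplex $T$ of $I\otimes\overline V$ such that $K$ is isomorphic in $\mathrm D^{\mathrm{adm}}(B)$ to $V/T$, the quotient of $V$ by $\mu_V(T)$. If these conditions hold, then in $\mathrm D^-(A)$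 $$K\otimes^{\mathbf L}_BA\;\simeq\;K\otimes_BA\,\oplus\,\bigl(\mathrm{Tor}^1_B(K,A)\otimes^{\mathbf L}_BA\bigr)[1]\;\simeq\;K\otimes_BA\,\oplus\,\bigoplus_{p\ge0}I^{\otimes p}\otimes\mathrm{Tor}^1_B(K,A)[p+1],$$ where in the middle term $\mathrm{Tor}^1_B(K,A)$ is regarded as a complex of $B$-modules via $\pi$. -/

import Mathlib

universe w w' v u

open CategoryTheory Limits Opposite

/-- A split extension `0 ⟶ I ⟶ B ⟶ A ⟶ 0` of the `k`-algebra `A` by the square zero ideal `I`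
(`incl` identifies the `A`-module `I` with the kernel of `proj`, on which `B` acts through `proj`,
so that `I ^ 2 = 0`), together with a splitting `sect`. -/
structure SplitSqZeroExtension (k : Type v) (A I B : Type u) [Field k] [CommRing A] [Algebra k A]
    [AddCommGroup I] [Module A I] [CommRing B] [Algebra k B] where
  incl : I →+ B
  proj : B →ₐ[k] A
  sect : A →ₐ[k] B
  incl_injective : Function.Injective incl
  proj_eq_zero_iff : ∀ b : B, proj b = 0 ↔ ∃ i : I, incl i = b
  mul_incl : ∀ (b : B) (i : I), b * incl i = incl (proj b • i)
  proj_sect : ∀ a : A, proj (sect a) = a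

namespace SplitSqZeroExtension

variable {k : Type v} {A I B : Type u} [Field k] [CommRing A] [Algebra k A]
  [AddCommGroup I] [Module A I] [CommRing B] [Algebra k B] (E : SplitSqZeroExtension k A I B)

/-- `M ↦ M ⊗_B A`. -/
noncomputable abbrev baseChange : ModuleCat.{u} B ⥤ ModuleCat.{u} A :=
  ModuleCat.extendScalars.{u, u, u} E.proj.toRingHom

/-- Restriction of scalars along the splitting `A ⟶ B`. -/
noncomputable abbrev viaSect : ModuleCat.{u} B ⥤ ModuleCat.{u} A :=
  ModuleCat.restrictScalars.{u} E.sect.toRingHom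

/-- Restriction of scalars along the projection `B ⟶ A`. -/
noncomputable abbrev viaProj : ModuleCat.{u} A ⥤ ModuleCat.{u} B :=
  ModuleCat.restrictScalars.{u} E.proj.toRingHom

/-- `M ↦ I ⊗_A (M ⊗_B A)`. -/
noncomputable abbrev idealTensor : ModuleCat.{u} B ⥤ ModuleCat.{u} A :=
  E.baseChange ⋙ MonoidalCategory.tensorLeft (ModuleCat.of A I)

open ChangeOfRings

/-- The `A`-linear map `M ⟶ M ⊗_B A`, `v ↦ 1 ⊗ v`. -/
noncomputable def toBaseChange : E.viaSect ⟶ E.baseChange where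
  app V := ModuleCat.ofHom (X := E.viaSect.obj V) (Y := E.baseChange.obj V)
    { toFun := fun v => (1 : A) ⊗ₜ[B, E.proj.toRingHom] (v : V)
      map_add' := fun v w =>
        map_add (ModuleCat.ExtendRestrictScalarsAdj.Unit.map E.proj.toRingHom (X := V)).hom v w
      map_smul' := fun a v => by
        refine (map_smul (ModuleCat.ExtendRestrictScalarsAdj.Unit.map E.proj.toRingHom
          (X := V)).hom (E.sect a) v).trans ?_
        change (E.proj (E.sect a)) •
          (show E.baseChange.obj V from (1 : A) ⊗ₜ[B, E.proj.toRingHom] (v : V)) = _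
        rw [E.proj_sect]
        rfl }
  naturality V W f := rfl

/-- `v ↦ (i ↦ i v)` -/
noncomputable def actionAux (V : ModuleCat.{u} B) :
    V ⟶ E.viaProj.obj (ModuleCat.of A (I →ₗ[A] E.viaSect.obj V)) :=
  ModuleCat.ofHom (Y := E.viaProj.obj (ModuleCat.of A (I →ₗ[A] E.viaSect.obj V)))
    { toFun := fun v =>
        { toFun := fun i => (E.incl i • v : V)
          map_add' := fun i j => by rw [map_add, add_smul]; rfl
          map_smul' := fun a i => by
            change E.incl (a • i) • v = E.sect a • E.incl i • v
            rw [← mul_smul, E.mul_incl, E.proj_sect] }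
      map_add' := fun v w => LinearMap.ext fun i => smul_add (E.incl i) v w
      map_smul' := fun b v => LinearMap.ext fun i => by
        change E.incl i • b • v = E.sect (E.proj b) • E.incl i • v
        rw [← mul_smul, ← mul_smul, E.mul_incl, E.proj_sect, ← E.mul_incl, mul_comm] }

/-- `M ⊗_B A ⟶ Hom_A(I, M)`, induced by `v ↦ (i ↦ i v)`. -/
noncomputable def actionHom (V : ModuleCat.{u} B) :
    E.baseChange.obj V →ₗ[A] I →ₗ[A] E.viaSect.obj V :=
  (ModuleCat.ExtendRestrictScalarsAdj.HomEquiv.fromExtendScalars E.proj.toRingHom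
    (E.actionAux V)).hom

lemma toBaseChange_surjective (V : ModuleCat.{u} B) :
    Function.Surjective (E.toBaseChange.app V).hom := by
  refine (ModuleCat.epi_iff_surjective (E.toBaseChange.app V)).1 ⟨fun g h w => ?_⟩
  exact ModuleCat.ExtendScalars.hom_ext fun v => congr($w v)

lemma actionHom_toBaseChange (V : ModuleCat.{u} B) (v : V) (i : I) :
    E.actionHom V ((E.toBaseChange.app V).hom v) i = (E.incl i • v : V) := by
  change E.sect 1 • E.incl i • v = _
  rw [map_one, one_smul]

/-- The multiplication map `I ⊗_A (M ⊗_B A) ⟶ M`, `i ⊗ (1 ⊗ v) ↦ i v`. -/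
noncomputable def mul : E.idealTensor ⟶ E.viaSect where
  app V := ModuleCat.ofHom (X := E.idealTensor.obj V) (Y := E.viaSect.obj V)
    (TensorProduct.lift (E.actionHom V).flip)
  naturality V W f := by
    refine ModuleCat.hom_ext (TensorProduct.ext' fun (i : I) (x : E.baseChange.obj V) => ?_)
    obtain ⟨v, rfl⟩ := E.toBaseChange_surjective V x
    refine (E.actionHom_toBaseChange W (f.hom v) i).trans ?_
    refine (map_smul f.hom (E.incl i) v).symm.trans ?_
    exact (congr_arg f.hom (E.actionHom_toBaseChange V v i)).symm

lemma mul_smul_eq (V : ModuleCat.{u} B) (b : B) (x : E.idealTensor.obj V) :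
    (E.mul.app V).hom (E.proj b • x) = (b • (show V from (E.mul.app V).hom x) : V) := by
  induction x using TensorProduct.induction_on with
  | zero =>
    rw [smul_zero, map_zero]; exact (smul_zero (A := V) b).symm
  | add x y hx hy =>
    rw [smul_add, map_add, map_add, hx, hy]
    exact (smul_add (A := V) b _ _).symm
  | tmul i x =>
    obtain ⟨v, rfl⟩ := E.toBaseChange_surjective V x
    refine (E.actionHom_toBaseChange V v (E.proj b • i)).trans ?_
    rw [← E.mul_incl]
    refine (mul_smul (β := V) b (E.incl i) v).trans ?_
    exact (congr_arg (fun w : V => b • w) (E.actionHom_toBaseChange V v i)).symm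

/-- The multiplication map, which is `B`-linear if `B` acts on the source through `A`. -/
noncomputable def mulB : E.idealTensor ⋙ E.viaProj ⟶ 𝟭 (ModuleCat.{u} B) where
  app V := ModuleCat.ofHom (X := E.viaProj.obj (E.idealTensor.obj V)) (Y := V)
    { toFun := fun x => (E.mul.app V).hom x
      map_add' := fun x y => map_add (E.mul.app V).hom x y
      map_smul' := fun b x => E.mul_smul_eq V b x }
  naturality V W f := by
    ext x
    exact congr($(E.mul.naturality f) x)

instance : E.baseChange.Additive :=
  (ModuleCat.extendRestrictScalarsAdj.{u, u, u} E.proj.toRingHom).left_adjoint_additive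
instance : E.idealTensor.Additive := inferInstance
instance : PreservesFiniteColimits E.baseChange := inferInstance
instance : PreservesFiniteColimits E.idealTensor := inferInstance
instance : PreservesFiniteLimits E.viaSect := inferInstance
instance : PreservesFiniteColimits E.viaSect := inferInstance

lemma incl_smul_mem_range (V : ModuleCat.{u} B) (i : I) (v : V) :
    ∃ x, (E.mulB.app V).hom x = E.incl i • v :=
  ⟨i ⊗ₜ[A] (E.toBaseChange.app V).hom v, E.actionHom_toBaseChange V v i⟩

lemma toBaseChange_smul (V : ModuleCat.{u} B) (b : B) (v : V) :
    (E.toBaseChange.app V).hom (b • v : V) = E.proj b • (E.toBaseChange.app V).hom v :=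
  map_smul (ModuleCat.ExtendRestrictScalarsAdj.Unit.map E.proj.toRingHom (X := V)).hom b v

lemma mul_comp_toBaseChange : E.mul ≫ E.toBaseChange = 0 := by
  ext V : 2
  refine ModuleCat.hom_ext (TensorProduct.ext' fun (i : I) (x : E.baseChange.obj V) => ?_)
  obtain ⟨v, rfl⟩ := E.toBaseChange_surjective V x
  refine (congr_arg (E.toBaseChange.app V).hom (E.actionHom_toBaseChange V v i)).trans ?_
  refine (E.toBaseChange_smul V _ v).trans ?_
  rw [(E.proj_eq_zero_iff _).2 ⟨i, rfl⟩, zero_smul]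
  rfl

lemma mul_toBaseChange_exact (V : ModuleCat.{u} B) :
    Function.Exact (E.mul.app V).hom (E.toBaseChange.app V).hom := by
  intro v
  constructor
  · intro hv
    let N : Submodule B V := LinearMap.range (E.mulB.app V).hom
    let q : V ⟶ E.viaProj.obj (E.viaSect.obj (ModuleCat.of B (V ⧸ N))) :=
      ModuleCat.ofHom (Y := E.viaProj.obj (E.viaSect.obj (ModuleCat.of B (V ⧸ N))))
        { toFun := fun v => N.mkQ v
          map_add' := fun v w => map_add N.mkQ v w
          map_smul' := fun b v => by
            change N.mkQ (b • v) = E.sect (E.proj b) • N.mkQ v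
            rw [← map_smul, ← sub_eq_zero, ← map_sub, ← sub_smul]
            obtain ⟨i, hi⟩ := (E.proj_eq_zero_iff (b - E.sect (E.proj b))).1
              (by rw [map_sub, E.proj_sect, sub_self])
            rw [← hi]
            exact (Submodule.Quotient.mk_eq_zero N).2 (E.incl_smul_mem_range V i v) }
    let r := ModuleCat.ExtendRestrictScalarsAdj.HomEquiv.fromExtendScalars E.proj.toRingHom q
    have h : (E.toBaseChange.app V ≫ r).hom v = N.mkQ v := by
      change E.sect 1 • N.mkQ v = N.mkQ v
      rw [map_one, one_smul]
    have h' : N.mkQ v = 0 := h.symm.trans ((congr_arg r.hom hv).trans (map_zero r.hom))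
    exact (Submodule.Quotient.mk_eq_zero N).1 h'
  · rintro ⟨x, rfl⟩
    exact congr($(congr_app E.mul_comp_toBaseChange V) x)

lemma mul_injective (P : ModuleCat.{u} B) [Projective P] :
    Function.Injective (E.mul.app P).hom := by
  have hP : Module.Projective B P := (IsProjective.iff_projective P).2 inferInstance
  let I' : ModuleCat.{u} B := E.viaProj.obj (ModuleCat.of A I)
  let ιB : I' →ₗ[B] B :=
    { toFun := fun i => E.incl i
      map_add' := fun i j => map_add E.incl i j
      map_smul' := fun b i => (E.mul_incl b i).symm }
  have hι : Function.Injective (LinearMap.rTensor P ιB) :=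
    Module.Flat.rTensor_preserves_injective_linearMap ιB E.incl_injective
  let ψ : TensorProduct B I' P →ₗ[B] E.viaProj.obj (E.idealTensor.obj P) :=
    TensorProduct.lift (LinearMap.mk₂ B
      (fun (i : I) (p : P) => i ⊗ₜ[A] (E.toBaseChange.app P).hom p)
      (fun i j p => TensorProduct.add_tmul _ _ _)
      (fun b i p => (TensorProduct.smul_tmul' (M := I) (E.proj b) i
        ((E.toBaseChange.app P).hom p)).symm)
      (fun i p q => (congr_arg (fun x => (show I from i) ⊗ₜ[A] x)
        (map_add (E.toBaseChange.app P).hom p q)).trans (TensorProduct.tmul_add (M := I) _ _ _))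
      (fun b i p => (congr_arg (fun x => (show I from i) ⊗ₜ[A] x)
        (E.toBaseChange_smul P b p)).trans (TensorProduct.tmul_smul (M := I) (E.proj b) _ _)))
  have hψ : Function.Surjective ψ := by
    intro x
    induction x using TensorProduct.induction_on with
    | zero => exact ⟨0, map_zero _⟩
    | add x y hx hy =>
      obtain ⟨v, rfl⟩ := hx
      obtain ⟨w, rfl⟩ := hy
      exact ⟨v + w, map_add _ v w⟩
    | tmul i x =>
      obtain ⟨v, rfl⟩ := E.toBaseChange_surjective P x
      exact ⟨(show I' from i) ⊗ₜ[B] v, rfl⟩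
  have hcomp : ∀ y, (E.mulB.app P).hom (ψ y) =
      TensorProduct.lid B P (LinearMap.rTensor P ιB y) := by
    intro y
    induction y using TensorProduct.induction_on with
    | zero => simp
    | add x y hx hy => rw [map_add, map_add, hx, hy, map_add, map_add]
    | tmul i p => exact E.actionHom_toBaseChange P p i
  refine (injective_iff_map_eq_zero (E.mul.app P).hom).2 fun x hx => ?_
  obtain ⟨y, rfl⟩ := hψ x
  have hy := (hcomp y).symm.trans hx
  have hy' : y = 0 := hι (((TensorProduct.lid B P).injective (hy.trans (map_zero _).symm)).trans
    (map_zero _).symm)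
  rw [hy']
  exact map_zero ψ

end SplitSqZeroExtension

namespace LeftDerivedOne

section

variable {C D : Type*} [Category* C] [Category* D] [Abelian C] [Abelian D]

/-- The canonical map `H₀(G P) ⟶ G V` for a projective resolution `P ⟶ V`. -/
noncomputable def homologyZeroTo {V : C} (P : ProjectiveResolution V) (G : C ⥤ D) [G.Additive] :
    ((G.mapHomologicalComplex (ComplexShape.down ℕ)).obj P.complex).homology 0 ⟶ G.obj V :=
  (ChainComplex.isoHomologyι₀ _).hom ≫ P.fromLeftDerivedZero' G

lemma homologyZeroTo_naturality {V W : C} (f : V ⟶ W) (P : ProjectiveResolution V)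
    (Q : ProjectiveResolution W) (φ : P.complex ⟶ Q.complex)
    (comm : φ.f 0 ≫ Q.π.f 0 = P.π.f 0 ≫ f) (G : C ⥤ D) [G.Additive] :
    HomologicalComplex.homologyMap ((G.mapHomologicalComplex _).map φ) 0 ≫ homologyZeroTo Q G =
      homologyZeroTo P G ≫ G.map f := by
  simp only [homologyZeroTo, Category.assoc]
  rw [← ProjectiveResolution.fromLeftDerivedZero'_naturality f P Q φ comm G]
  simp

lemma homologyZeroTo_natTrans {V : C} (P : ProjectiveResolution V) {G H : C ⥤ D}
    [G.Additive] [H.Additive] (α : G ⟶ H) :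
    HomologicalComplex.homologyMap
      ((NatTrans.mapHomologicalComplex α (ComplexShape.down ℕ)).app P.complex) 0 ≫
        homologyZeroTo P H = homologyZeroTo P G ≫ α.app V := by
  simp only [homologyZeroTo, Category.assoc]
  have : HomologicalComplex.opcyclesMap
      ((NatTrans.mapHomologicalComplex α (ComplexShape.down ℕ)).app P.complex) 0 ≫
      P.fromLeftDerivedZero' H = P.fromLeftDerivedZero' G ≫ α.app V := by
    rw [← cancel_epi (HomologicalComplex.pOpcycles _ _)]
    simp only [HomologicalComplex.p_opcyclesMap_assoc,
      ProjectiveResolution.pOpcycles_comp_fromLeftDerivedZero',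
      ProjectiveResolution.pOpcycles_comp_fromLeftDerivedZero'_assoc,
      NatTrans.mapHomologicalComplex_app_f]
    exact (α.naturality _).symm
  rw [← this]
  simp

instance {V : C} (P : ProjectiveResolution V) (G : C ⥤ D) [G.Additive]
    [PreservesFiniteColimits G] : IsIso (homologyZeroTo P G) := by
  unfold homologyZeroTo
  infer_instance

variable {J S F : C ⥤ D} [J.Additive] [S.Additive] [F.Additive]
  (μ : J ⟶ S) (ε : S ⟶ F) (w : μ ≫ ε = 0)

noncomputable abbrev resolutionSequence (P : ChainComplex C ℕ) :
    ShortComplex (ChainComplex D ℕ) :=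
  ShortComplex.mk ((NatTrans.mapHomologicalComplex μ (ComplexShape.down ℕ)).app P)
    ((NatTrans.mapHomologicalComplex ε (ComplexShape.down ℕ)).app P) (by
      ext n
      exact congr_app w (P.X n))

lemma resolutionSequence_shortExact
    (h : ∀ (P : C) [Projective P],
      (ShortComplex.mk (μ.app P) (ε.app P) (congr_app w P)).ShortExact)
    {V : C} (P : ProjectiveResolution V) :
    (resolutionSequence μ ε w P.complex).ShortExact :=
  HomologicalComplex.shortExact_of_degreewise_shortExact _ fun n => h (P.complex.X n)

noncomputable def resolutionδ
    (h : ∀ (P : C) [Projective P],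
      (ShortComplex.mk (μ.app P) (ε.app P) (congr_app w P)).ShortExact)
    {V : C} (P : ProjectiveResolution V) :
    ((F.mapHomologicalComplex (ComplexShape.down ℕ)).obj P.complex).homology 1 ⟶
      ((J.mapHomologicalComplex (ComplexShape.down ℕ)).obj P.complex).homology 0 :=
  (resolutionSequence_shortExact μ ε w h P).δ 1 0 (by simp)

lemma resolutionδ_naturality
    (h : ∀ (P : C) [Projective P],
      (ShortComplex.mk (μ.app P) (ε.app P) (congr_app w P)).ShortExact)
    {V W : C} (P : ProjectiveResolution V) (Q : ProjectiveResolution W)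
    (φ : P.complex ⟶ Q.complex) :
    HomologicalComplex.homologyMap ((F.mapHomologicalComplex _).map φ) 1 ≫
      resolutionδ μ ε w h Q = resolutionδ μ ε w h P ≫
        HomologicalComplex.homologyMap ((J.mapHomologicalComplex _).map φ) 0 :=
  (HomologicalComplex.HomologySequence.δ_naturality
    (S₁ := resolutionSequence μ ε w P.complex) (S₂ := resolutionSequence μ ε w Q.complex)
    { τ₁ := (J.mapHomologicalComplex _).map φ
      τ₂ := (S.mapHomologicalComplex _).map φ
      τ₃ := (F.mapHomologicalComplex _).map φ }
    (resolutionSequence_shortExact μ ε w h P)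
    (resolutionSequence_shortExact μ ε w h Q) 1 0 (by simp)).symm

noncomputable def leftDerivedOneIso [HasProjectiveResolutions C]
    {V : C} (P : ProjectiveResolution V) (F : C ⥤ D) [F.Additive] :
    (F.leftDerived 1).obj V ≅
      ((F.mapHomologicalComplex (ComplexShape.down ℕ)).obj P.complex).homology 1 :=
  P.isoLeftDerivedObj F 1

lemma leftDerivedOneIso_naturality [HasProjectiveResolutions C]
    {V W : C} (f : V ⟶ W) (P : ProjectiveResolution V)
    (Q : ProjectiveResolution W) (φ : P.complex ⟶ Q.complex)
    (comm : φ.f 0 ≫ Q.π.f 0 = P.π.f 0 ≫ f) (F : C ⥤ D) [F.Additive] :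
    (F.leftDerived 1).map f ≫ (leftDerivedOneIso Q F).hom =
      (leftDerivedOneIso P F).hom ≫
        HomologicalComplex.homologyMap ((F.mapHomologicalComplex _).map φ) 1 :=
  ProjectiveResolution.isoLeftDerivedObj_hom_naturality f P Q φ comm F 1

/-- The natural transformation `L₁F ⟶ J` attached to natural transformations `J ⟶ S ⟶ F` which are
short exact on projective objects: the connecting morphism `H₁(F P) ⟶ H₀(J P)` for a projective
resolution `P ⟶ V`, followed by `H₀(J P) ⟶ J V`. -/
noncomputable def connecting [HasProjectiveResolutions C]
    (h : ∀ (P : C) [Projective P],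
      (ShortComplex.mk (μ.app P) (ε.app P) (congr_app w P)).ShortExact) :
    F.leftDerived 1 ⟶ J where
  app V := (leftDerivedOneIso (projectiveResolution V) F).hom ≫
    resolutionδ μ ε w h (projectiveResolution V) ≫ homologyZeroTo (projectiveResolution V) J
  naturality V W f := by
    let φ := ProjectiveResolution.lift f (projectiveResolution V) (projectiveResolution W)
    have comm : φ.f 0 ≫ (projectiveResolution W).π.f 0 = (projectiveResolution V).π.f 0 ≫ f := by
      have := congr_arg (fun g => g.f 0) (ProjectiveResolution.lift_commutes f
        (projectiveResolution V) (projectiveResolution W))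
      refine this.trans ?_
      rw [HomologicalComplex.comp_f, ChainComplex.single₀_map_f_zero]
      rfl
    have h₁ := leftDerivedOneIso_naturality f _ _ φ comm F
    have h₂ := resolutionδ_naturality μ ε w h (projectiveResolution V) (projectiveResolution W) φ
    have h₃ := homologyZeroTo_naturality f _ _ φ comm J
    rw [Category.assoc, Category.assoc, ← h₃, reassoc_of% h₁, reassoc_of% h₂]

lemma connecting_mono [HasProjectiveResolutions C] [PreservesFiniteLimits S]
    [PreservesFiniteColimits S] [PreservesFiniteColimits J]
    (h : ∀ (P : C) [Projective P],
      (ShortComplex.mk (μ.app P) (ε.app P) (congr_app w P)).ShortExact) (V : C) :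
    Mono ((connecting μ ε w h).app V) := by
  have : Mono (resolutionδ μ ε w h (projectiveResolution V)) := by
    refine (resolutionSequence_shortExact μ ε w h (projectiveResolution V)).mono_δ 1 0 (by simp) ?_
    rw [← HomologicalComplex.exactAt_iff_isZero_homology]
    exact ((projectiveResolution V).complex_exactAt_succ 0).map S
  dsimp only [connecting]
  infer_instance

lemma connecting_comp [HasProjectiveResolutions C]
    (h : ∀ (P : C) [Projective P],
      (ShortComplex.mk (μ.app P) (ε.app P) (congr_app w P)).ShortExact) (V : C) :
    (connecting μ ε w h).app V ≫ μ.app V = 0 := by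
  dsimp only [connecting]
  rw [Category.assoc, Category.assoc, ← homologyZeroTo_natTrans]
  have : resolutionδ μ ε w h (projectiveResolution V) ≫ HomologicalComplex.homologyMap
      ((NatTrans.mapHomologicalComplex μ (ComplexShape.down ℕ)).app _) 0 = 0 :=
    (resolutionSequence_shortExact μ ε w h (projectiveResolution V)).δ_comp 1 0 (by simp)
  rw [reassoc_of% this]
  simp

lemma connecting_exact [HasProjectiveResolutions C]
    [PreservesFiniteColimits S] [PreservesFiniteColimits J]
    (h : ∀ (P : C) [Projective P],
      (ShortComplex.mk (μ.app P) (ε.app P) (congr_app w P)).ShortExact) (V : C) :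
    (ShortComplex.mk _ _ (connecting_comp μ ε w h V)).Exact := by
  have H := (resolutionSequence_shortExact μ ε w h (projectiveResolution V)).homology_exact₁
    1 0 (by simp)
  refine (ShortComplex.exact_iff_of_iso (ShortComplex.isoMk
    (leftDerivedOneIso (projectiveResolution V) F)
    (asIso (homologyZeroTo (projectiveResolution V) J)).symm
    (asIso (homologyZeroTo (projectiveResolution V) S)).symm ?_ ?_)).2 H
  · have : (connecting μ ε w h).app V ≫ inv (homologyZeroTo (projectiveResolution V) J) =
        (leftDerivedOneIso (projectiveResolution V) F).hom ≫
          resolutionδ μ ε w h (projectiveResolution V) := by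
      simp [connecting]
    exact this.symm
  · have := homologyZeroTo_natTrans (projectiveResolution V) μ
    simp only [Iso.symm_hom, asIso_inv]
    have h' : inv (homologyZeroTo (projectiveResolution V) J) ≫ HomologicalComplex.homologyMap
        ((NatTrans.mapHomologicalComplex μ (ComplexShape.down ℕ)).app _) 0 =
        μ.app V ≫ inv (homologyZeroTo (projectiveResolution V) S) := by
      rw [IsIso.inv_comp_eq, ← Category.assoc, ← this]
      simp
    exact h'

end

end LeftDerivedOne

namespace ProjectiveModels

section

variable {C : Type u} [Category.{v} C] [Abelian C]

lemma quasiIsoAt_op_iff {K L : CochainComplex C ℤ} (f : K ⟶ L) (m : ℤ) :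
    QuasiIsoAt ((CochainComplex.opEquivalence C).functor.map f.op) m ↔ QuasiIsoAt f (-m) := by
  rw [quasiIsoAt_iff' _ (m-1) m (m+1) (by simp) (by simp),
    quasiIsoAt_iff' _ (-(m+1)) (-m) (-(m-1)) (by simp; lia) (by simp; lia)]
  exact ShortComplex.quasiIso_opMap_iff
    ((HomologicalComplex.shortComplexFunctor' C (.up ℤ) (-(m+1)) (-m) (-(m-1))).map f)

lemma quasiIso_op_iff {K L : CochainComplex C ℤ} (f : K ⟶ L) :
    QuasiIso ((CochainComplex.opEquivalence C).functor.map f.op) ↔ QuasiIso f := by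
  rw [quasiIso_iff, quasiIso_iff]
  refine ⟨fun h n => ?_, fun h n => (quasiIsoAt_op_iff f n).2 (h _)⟩
  have := (quasiIsoAt_op_iff f (-n)).1 (h _)
  rwa [neg_neg] at this

lemma exists_projective [EnoughProjectives C] (K : CochainComplex C ℤ) (b : ℤ)
    [K.IsStrictlyLE b] :
    ∃ (P : CochainComplex C ℤ) (p : P ⟶ K), QuasiIso p ∧ (∀ n, Projective (P.X n)) ∧
      P.IsStrictlyLE b := by
  let e := CochainComplex.opEquivalence C
  let L := e.functor.obj (op K)
  have : L.IsStrictlyGE (-b) := by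
    rw [CochainComplex.isStrictlyGE_iff]
    intro i hi
    exact (K.isZero_of_isStrictlyLE b (-i) (by lia)).op
  obtain ⟨M, i, hi, hM, hM'⟩ :=
    CochainComplex.Plus.modelCategoryQuillen.exists_quasiIso_injective L (-b)
  let P := (e.inverse.obj M).unop
  let p : P ⟶ K := (e.unitIso.hom.app (op K) ≫ e.inverse.map i).unop
  refine ⟨P, p, ?_, ?_, ?_⟩
  · rw [← quasiIso_op_iff]
    have : e.functor.map p.op = i ≫ (e.counitIso.app M).inv := by
      rw [← cancel_mono (e.counitIso.app M).hom]
      change e.functor.map (e.unitIso.hom.app (op K) ≫ e.inverse.map i) ≫ e.counitIso.hom.app M = _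
      simp [L]
    have h : QuasiIso (e.functor.map p.op) := by
      rw [this]; infer_instance
    exact h
  · intro n
    have := hM (-n)
    exact (Injective.projective_iff_injective_op).2 this
  · rw [CochainComplex.isStrictlyLE_iff]
    intro i hi
    exact (M.isZero_of_isStrictlyGE (-b) (-i) (by lia)).unop

end

section

variable {C : Type u} [Category.{v} C] [Abelian C] [HasDerivedCategory.{w} C]

/-- A bounded above complex of projective objects representing an object of the derived
category. -/
structure Model (X : DerivedCategory C) where
  complex : CochainComplex C ℤ
  bound : ℤ
  isStrictlyLE : complex.IsStrictlyLE bound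
  projective : ∀ n, Projective (complex.X n)
  iso : DerivedCategory.Qh.obj ((HomotopyCategory.quotient C (.up ℤ)).obj complex) ≅ X

lemma Model.isKProjective {X : DerivedCategory C} (P : Model X) : P.complex.IsKProjective :=
  have := P.isStrictlyLE
  have := P.projective
  CochainComplex.isKProjective_of_projective P.complex P.bound

/-- Bounded above cochain complexes. -/
def boundedAbove (C : Type u) [Category.{v} C] [Abelian C] :
    ObjectProperty (CochainComplex C ℤ) :=
  fun K => ∃ n : ℤ, K.IsStrictlyLE n

/-- Bounded complexes concentrated in cohomological degrees `≤ b`, i.e. in homological degrees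
`≥ -b`. -/
def boundedLE (C : Type*) [Category* C] [Abelian C] (b : ℤ) :
    ObjectProperty (CochainComplex C ℤ) :=
  fun K => K.IsStrictlyLE b ∧ ∃ a : ℤ, K.IsStrictlyGE a

lemma boundedLE.boundedAbove {C : Type*} [Category* C] [Abelian C] {b : ℤ}
    {K : CochainComplex C ℤ} (hK : boundedLE C b K) : ProjectiveModels.boundedAbove C K :=
  ⟨b, hK.1⟩

/-- The homotopy category `K⁻(C)` as a full subcategory of `K(C)`. -/
def homotopyMinus (C : Type*) [Category* C] [Abelian C] :
    ObjectProperty (HomotopyCategory C (.up ℤ)) :=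
  (boundedAbove C).strictMap (HomotopyCategory.quotient C (.up ℤ))

/-- The object of `D⁻` given by a bounded above complex. -/
noncomputable def toMinus (K : CochainComplex C ℤ) (hK : boundedAbove C K) :
    DerivedCategory.Minus C :=
  ⟨DerivedCategory.Q.obj K, by
    obtain ⟨n, hn⟩ := hK
    exact ⟨n, K, Iso.refl _, hn⟩⟩

lemma nonempty_model [EnoughProjectives C] (X : DerivedCategory.Minus C) :
    Nonempty (Model X.obj) := by
  obtain ⟨n, K, e, hK⟩ := X.property
  obtain ⟨P, p, hp, hP, hP'⟩ := exists_projective K n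
  exact ⟨⟨P, n, hP', hP, (DerivedCategory.quotientCompQhIso C).app P ≪≫
    asIso (DerivedCategory.Q.map p) ≪≫ e.symm⟩⟩

/-- A chosen projective model. -/
noncomputable def model [EnoughProjectives C] (X : DerivedCategory.Minus C) : Model X.obj :=
  (nonempty_model X).some

/-- The unique homotopy class out of a projective model that represents a given morphism of the
derived category. -/
noncomputable def Model.lift {X : DerivedCategory C} (P : Model X)
    {L : HomotopyCategory C (.up ℤ)} (f : X ⟶ DerivedCategory.Qh.obj L) :
    (HomotopyCategory.quotient C (.up ℤ)).obj P.complex ⟶ L :=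
  have := P.isKProjective
  ((CochainComplex.IsKProjective.Qh_map_bijective P.complex L).surjective
    (P.iso.hom ≫ f)).choose

@[simp]
lemma Model.Qh_map_lift {X : DerivedCategory C} (P : Model X)
    {L : HomotopyCategory C (.up ℤ)} (f : X ⟶ DerivedCategory.Qh.obj L) :
    DerivedCategory.Qh.map (P.lift f) = P.iso.hom ≫ f :=
  have := P.isKProjective
  ((CochainComplex.IsKProjective.Qh_map_bijective P.complex L).surjective
    (P.iso.hom ≫ f)).choose_spec

lemma Model.hom_ext {X : DerivedCategory C} (P : Model X)
    {L : HomotopyCategory C (.up ℤ)}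
    {f g : (HomotopyCategory.quotient C (.up ℤ)).obj P.complex ⟶ L}
    (h : DerivedCategory.Qh.map f = DerivedCategory.Qh.map g) : f = g :=
  have := P.isKProjective
  (CochainComplex.IsKProjective.Qh_map_bijective P.complex L).injective h

variable {D : Type*} [Category* D] [Abelian D] [HasDerivedCategory.{w'} D]
  (F : C ⥤ D) [F.Additive]

/-- The total left derived functor `D⁻(C) ⥤ D(D)`, computed on projective models. -/
noncomputable def leftDerivedMinus [EnoughProjectives C] :
    DerivedCategory.Minus C ⥤ DerivedCategory D where
  obj X := DerivedCategory.Qh.obj ((F.mapHomotopyCategory (.up ℤ)).obj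
    ((HomotopyCategory.quotient C (.up ℤ)).obj (model X).complex))
  map {X Y} f := DerivedCategory.Qh.map ((F.mapHomotopyCategory (.up ℤ)).map
    ((model X).lift (f.hom ≫ (model Y).iso.inv)))
  map_id X := by
    rw [← CategoryTheory.Functor.map_id, ← CategoryTheory.Functor.map_id]
    congr 2
    exact (model X).hom_ext (by simp)
  map_comp {X Y Z} f g := by
    rw [← Functor.map_comp, ← Functor.map_comp]
    congr 2
    exact (model X).hom_ext (by simp)

/-- The canonical morphism from the derived functor to the functor applied termwise. -/
noncomputable def fromLeftDerivedMinus [EnoughProjectives C] (K : CochainComplex C ℤ)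
    (hK : boundedAbove C K) :
    (leftDerivedMinus F).obj (toMinus K hK) ⟶
      DerivedCategory.Q.obj ((F.mapHomologicalComplex (.up ℤ)).obj K) :=
  DerivedCategory.Qh.map ((F.mapHomotopyCategory (.up ℤ)).map
      ((model (toMinus K hK)).lift ((DerivedCategory.quotientCompQhIso C).inv.app K))) ≫
    DerivedCategory.Qh.map ((F.mapHomotopyCategoryFactors (.up ℤ)).hom.app K) ≫
    (DerivedCategory.quotientCompQhIso D).hom.app
      ((F.mapHomologicalComplex (.up ℤ)).obj K)

end

end ProjectiveModels
lemma leftDerived_additive {C D : Type*} [Category* C] [Category* D] [Abelian C] [Abelian D]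
    [HasProjectiveResolutions C] (F : C ⥤ D) [F.Additive] (n : ℕ) : (F.leftDerived n).Additive where
  map_add {X Y f g} := by
    have hf := ProjectiveResolution.lift_commutes f (projectiveResolution X) (projectiveResolution Y)
    have hg := ProjectiveResolution.lift_commutes g (projectiveResolution X) (projectiveResolution Y)
    rw [F.leftDerived_map_eq n f _ hf, F.leftDerived_map_eq n g _ hg,
      F.leftDerived_map_eq n (f + g) (ProjectiveResolution.lift f (projectiveResolution X)
        (projectiveResolution Y) + ProjectiveResolution.lift g (projectiveResolution X)
        (projectiveResolution Y)) (by rw [Preadditive.add_comp, hf, hg, Functor.map_add,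
          Preadditive.comp_add])]
    rw [Functor.map_add, Preadditive.add_comp, Preadditive.comp_add]

namespace YonedaTwo

section

variable {C : Type u} [Category.{v} C] [Abelian C]
  {T J S F : CochainComplex C ℤ} (t : T ⟶ J) (m : J ⟶ S) (e : S ⟶ F)
  (htm : t ≫ m = 0) (hme : m ≫ e = 0)

lemma left_shortExact [Mono t] (h₁ : (ShortComplex.mk t m htm).Exact)
    (h₂ : (ShortComplex.mk m e hme).Exact) :
    (ShortComplex.mk t (kernel.lift e m hme)
      (by rw [← cancel_mono (kernel.ι e)]; simpa using htm)).ShortExact where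
  exact := by
    refine (ShortComplex.exact_iff_of_epi_of_isIso_of_mono
      (S₁ := ShortComplex.mk t (kernel.lift e m hme)
        (by rw [← cancel_mono (kernel.ι e)]; simpa using htm))
      (S₂ := ShortComplex.mk t m htm)
      { τ₁ := 𝟙 _, τ₂ := 𝟙 _, τ₃ := kernel.ι e }).2 h₁
  mono_f := inferInstance
  epi_g := h₂.epi_kernelLift

lemma right_shortExact [Epi e] :
    (ShortComplex.mk (kernel.ι e) e (kernel.condition e)).ShortExact where
  exact := ShortComplex.exact_kernel e

/-- The class `F ⟶ T[2]` in the derived category of an exact sequence of complexes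
`0 ⟶ T ⟶ J ⟶ S ⟶ F ⟶ 0`: the composition of the connecting morphisms of the two short
exact sequences into which it splits at `ker (S ⟶ F) = im (J ⟶ S)`. -/
noncomputable def extClass [HasDerivedCategory.{w} C] [Mono t] [Epi e]
    (h₁ : (ShortComplex.mk t m htm).Exact) (h₂ : (ShortComplex.mk m e hme).Exact) :
    DerivedCategory.Q.obj F ⟶ (DerivedCategory.Q.obj T)⟦(2 : ℤ)⟧ :=
  DerivedCategory.triangleOfSESδ (right_shortExact e) ≫
    (DerivedCategory.triangleOfSESδ (left_shortExact t m e htm hme h₁ h₂))⟦(1 : ℤ)⟧' ≫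
    (shiftFunctorAdd' (DerivedCategory C) (1 : ℤ) 1 2 (by norm_num)).inv.app
      (DerivedCategory.Q.obj T)

end

end YonedaTwo

namespace SplitSqZeroExtension

section

variable {k : Type v} {A I B : Type u} [Field k] [CommRing A] [Algebra k A]
  [AddCommGroup I] [Module A I] [CommRing B] [Algebra k B] (E : SplitSqZeroExtension k A I B)

/-- `M ↦ Tor₁^B(M, A)`. -/
noncomputable abbrev tor₁ : ModuleCat.{u} B ⥤ ModuleCat.{u} A :=
  E.baseChange.leftDerived 1

instance tor₁_additive : E.tor₁.Additive := leftDerived_additive _ _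

lemma projective_shortExact (P : ModuleCat.{u} B) [Projective P] :
    (ShortComplex.mk (E.mul.app P) (E.toBaseChange.app P)
      (congr_app E.mul_comp_toBaseChange P)).ShortExact where
  exact := (ShortComplex.ShortExact.moduleCat_exact_iff_function_exact _).2
    (E.mul_toBaseChange_exact P)
  mono_f := (ModuleCat.mono_iff_injective _).2 (E.mul_injective P)
  epi_g := (ModuleCat.epi_iff_surjective _).2 (E.toBaseChange_surjective P)

/-- The inclusion `Tor₁^B(M, A) ⟶ I ⊗ (M ⊗_B A)`: the connecting morphism of the sequence
`0 ⟶ I ⟶ B ⟶ A ⟶ 0` tensored with `M`. -/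
noncomputable def torInclusion : E.tor₁ ⟶ E.idealTensor :=
  LeftDerivedOne.connecting E.mul E.toBaseChange E.mul_comp_toBaseChange
    fun P _ => E.projective_shortExact P

/-- `K ↦ K ⊗_B A`, termwise. -/
noncomputable abbrev baseChangeC :
    CochainComplex (ModuleCat.{u} B) ℤ ⥤ CochainComplex (ModuleCat.{u} A) ℤ :=
  E.baseChange.mapHomologicalComplex (.up ℤ)

/-- `K ↦ Tor₁^B(K, A)`, termwise. -/
noncomputable abbrev tor₁C :
    CochainComplex (ModuleCat.{u} B) ℤ ⥤ CochainComplex (ModuleCat.{u} A) ℤ :=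
  E.tor₁.mapHomologicalComplex (.up ℤ)

/-- `K ↦ I ⊗_A (K ⊗_B A)`, termwise. -/
noncomputable abbrev idealTensorC :
    CochainComplex (ModuleCat.{u} B) ℤ ⥤ CochainComplex (ModuleCat.{u} A) ℤ :=
  E.idealTensor.mapHomologicalComplex (.up ℤ)

/-- Termwise restriction of scalars along the splitting. -/
noncomputable abbrev viaSectC :
    CochainComplex (ModuleCat.{u} B) ℤ ⥤ CochainComplex (ModuleCat.{u} A) ℤ :=
  E.viaSect.mapHomologicalComplex (.up ℤ)

/-- Termwise restriction of scalars along the projection. -/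
noncomputable abbrev viaProjC :
    CochainComplex (ModuleCat.{u} A) ℤ ⥤ CochainComplex (ModuleCat.{u} B) ℤ :=
  E.viaProj.mapHomologicalComplex (.up ℤ)

section

variable (K : CochainComplex (ModuleCat.{u} B) ℤ)

noncomputable abbrev torInclusionC : E.tor₁C.obj K ⟶ E.idealTensorC.obj K :=
  (NatTrans.mapHomologicalComplex E.torInclusion (.up ℤ)).app K

noncomputable abbrev mulC : E.idealTensorC.obj K ⟶ E.viaSectC.obj K :=
  (NatTrans.mapHomologicalComplex E.mul (.up ℤ)).app K

noncomputable abbrev toBaseChangeC : E.viaSectC.obj K ⟶ E.baseChangeC.obj K :=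
  (NatTrans.mapHomologicalComplex E.toBaseChange (.up ℤ)).app K

instance torInclusionC_mono : Mono (E.torInclusionC K) :=
  HomologicalComplex.mono_of_mono_f _ fun n =>
    LeftDerivedOne.connecting_mono E.mul E.toBaseChange E.mul_comp_toBaseChange _ (K.X n)

instance toBaseChangeC_epi : Epi (E.toBaseChangeC K) :=
  HomologicalComplex.epi_of_epi_f _ fun n =>
    (ModuleCat.epi_iff_surjective _).2 (E.toBaseChange_surjective (K.X n))

lemma torInclusionC_mulC : E.torInclusionC K ≫ E.mulC K = 0 := by
  ext n : 1
  exact LeftDerivedOne.connecting_comp E.mul E.toBaseChange E.mul_comp_toBaseChange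
    (fun P _ => E.projective_shortExact P) (K.X n)

lemma mulC_toBaseChangeC : E.mulC K ≫ E.toBaseChangeC K = 0 := by
  ext n : 1
  exact congr_app E.mul_comp_toBaseChange (K.X n)

lemma torInclusionC_mulC_exact :
    (ShortComplex.mk _ _ (E.torInclusionC_mulC K)).Exact :=
  HomologicalComplex.exact_of_degreewise_exact _ fun n =>
    LeftDerivedOne.connecting_exact E.mul E.toBaseChange E.mul_comp_toBaseChange
      (fun P _ => E.projective_shortExact P) (K.X n)

lemma mulC_toBaseChangeC_exact :
    (ShortComplex.mk _ _ (E.mulC_toBaseChangeC K)).Exact :=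
  HomologicalComplex.exact_of_degreewise_exact _ fun n =>
    (ShortComplex.ShortExact.moduleCat_exact_iff_function_exact _).2
      (E.mul_toBaseChange_exact (K.X n))

/-- The local HKR class `K ⊗_B A ⟶ Tor₁^B(K, A)[2]`, the class in the derived category of `A` of
`0 ⟶ Tor₁^B(K, A) ⟶ I ⊗ (K ⊗_B A) ⟶ K ⟶ K ⊗_B A ⟶ 0`, where `A` acts on `K` via the splitting. -/
noncomputable def hkrClass [HasDerivedCategory.{w} (ModuleCat.{u} A)] :
    DerivedCategory.Q.obj (E.baseChangeC.obj K) ⟶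
      (DerivedCategory.Q.obj (E.tor₁C.obj K))⟦(2 : ℤ)⟧ :=
  YonedaTwo.extClass (E.torInclusionC K) (E.mulC K) (E.toBaseChangeC K)
    (E.torInclusionC_mulC K) (E.mulC_toBaseChangeC K)
    (E.torInclusionC_mulC_exact K) (E.mulC_toBaseChangeC_exact K)

/-- The termwise `Tor₁^B(V, A)` is acyclic. -/
def Admissible : Prop := (E.tor₁C.obj K).Acyclic

end

section Dadm

/-- Complexes `K` such that `K ⊗_B A` and `Tor₁^B(K, A)` are exact. -/
def nullSystem : ObjectProperty (HomotopyCategory (ModuleCat.{u} B) (.up ℤ)) :=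
  (HomotopyCategory.subcategoryAcyclic (ModuleCat.{u} A)).inverseImage
      (E.baseChange.mapHomotopyCategory (.up ℤ)) ⊓
    (HomotopyCategory.subcategoryAcyclic (ModuleCat.{u} A)).inverseImage
      (E.tor₁.mapHomotopyCategory (.up ℤ))

/-- The morphisms of `K⁻(B)` with cone in the null system. -/
def admissibleW : MorphismProperty (ProjectiveModels.homotopyMinus (ModuleCat.{u} B)).FullSubcategory :=
  E.nullSystem.trW.inverseImage (ProjectiveModels.homotopyMinus (ModuleCat.{u} B)).ι

/-- The admissible derived category: the localization of `K⁻(B)` at the null system. -/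
abbrev DerivedAdm := E.admissibleW.Localization

/-- The object of the admissible derived category given by a bounded above complex. -/
noncomputable def toDerivedAdm (K : CochainComplex (ModuleCat.{u} B) ℤ)
    (hK : ProjectiveModels.boundedAbove _ K) : E.DerivedAdm :=
  E.admissibleW.Q.obj ⟨(HomotopyCategory.quotient _ _).obj K, ⟨K, hK⟩⟩

lemma admissibleW_isInvertedBy [HasDerivedCategory.{w} (ModuleCat.{u} A)] :
    E.admissibleW.IsInvertedBy ((ProjectiveModels.homotopyMinus (ModuleCat.{u} B)).ι ⋙
      E.baseChange.mapHomotopyCategory (.up ℤ) ⋙ DerivedCategory.Qh) := by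
  intro X Y f hf
  exact ObjectProperty.inverseImage_trW_isInverted
    (P := HomotopyCategory.subcategoryAcyclic (ModuleCat.{u} A))
    (F := E.baseChange.mapHomotopyCategory (.up ℤ)) DerivedCategory.Qh _
    (ObjectProperty.trW_monotone inf_le_left _ hf)

/-- The functor `K ↦ K ⊗_B A` from the admissible derived category of `B` to the derived
category of `A`. -/
noncomputable def baseChangeAdm [HasDerivedCategory.{w} (ModuleCat.{u} A)] :
    E.DerivedAdm ⥤ DerivedCategory (ModuleCat.{u} A) :=
  Localization.Construction.lift _ E.admissibleW_isInvertedBy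

end Dadm

/-- The complex `I^{⊗ p} ⊗ Tor₁^B(K, A)`, tensor products being over `A`. -/
noncomputable abbrev tensorPowerTor (K : CochainComplex (ModuleCat.{u} B) ℤ) (p : ℕ) :
    CochainComplex (ModuleCat.{u} A) ℤ :=
  ((MonoidalCategory.tensorLeft (ModuleCat.of A (TensorPower A p I))).mapHomologicalComplex
    (.up ℤ)).obj (E.tor₁C.obj K)

lemma tor₁C_boundedAbove (K : CochainComplex (ModuleCat.{u} B) ℤ)
    (hK : ProjectiveModels.boundedAbove _ K) :
    ProjectiveModels.boundedAbove _ (E.viaProjC.obj (E.tor₁C.obj K)) := by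
  obtain ⟨n, hn⟩ := hK
  refine ⟨n, ?_⟩
  rw [CochainComplex.isStrictlyLE_iff]
  intro i hi
  exact E.viaProj.map_isZero (E.tor₁.map_isZero (K.isZero_of_isStrictlyLE n i hi))

section Quotient

variable (V : CochainComplex (ModuleCat.{u} B) ℤ) {T : CochainComplex (ModuleCat.{u} A) ℤ}
  (t : T ⟶ E.idealTensorC.obj V)

/-- The multiplication map, as a `B`-linear morphism of complexes. -/
noncomputable def mulBC : E.viaProjC.obj (E.idealTensorC.obj V) ⟶ V where
  f n := E.mulB.app (V.X n)
  comm' i j _ := (E.mulB.naturality (V.d i j)).symm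

/-- `V / T` for `T ⊆ I ⊗ (V ⊗_B A)`: the quotient of `V` by the image of `T` under
multiplication. -/
noncomputable def quotientComplex : CochainComplex (ModuleCat.{u} B) ℤ :=
  cokernel (E.viaProjC.map t ≫ E.mulBC V)

/-- The projection `V ⟶ V / T`. -/
noncomputable def quotientComplexπ : V ⟶ E.quotientComplex V t :=
  cokernel.π (E.viaProjC.map t ≫ E.mulBC V)

instance quotientComplexπ_epi : Epi (E.quotientComplexπ V t) :=
  inferInstanceAs (Epi (cokernel.π (E.viaProjC.map t ≫ E.mulBC V)))

lemma quotientComplex_boundedAbove (hV : ProjectiveModels.boundedAbove _ V) :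
    ProjectiveModels.boundedAbove _ (E.quotientComplex V t) := by
  obtain ⟨n, hn⟩ := hV
  refine ⟨n, ?_⟩
  rw [CochainComplex.isStrictlyLE_iff]
  intro i hi
  have : Epi ((E.quotientComplexπ V t).f i) :=
    inferInstanceAs (Epi ((HomologicalComplex.eval _ _ i).map (E.quotientComplexπ V t)))
  exact IsZero.of_epi ((E.quotientComplexπ V t).f i) (V.isZero_of_isStrictlyLE n i hi)

end Quotient

section

variable [HasDerivedCategory.{w} (ModuleCat.{u} A)] [HasDerivedCategory.{w'} (ModuleCat.{u} B)]

/-- `- ⊗ᴸ_B A : D⁻(B) ⥤ D(A)` -/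
noncomputable abbrev derivedBaseChange :
    DerivedCategory.Minus (ModuleCat.{u} B) ⥤ DerivedCategory (ModuleCat.{u} A) :=
  ProjectiveModels.leftDerivedMinus E.baseChange

/-- `K ⊗ᴸ_B A ⟶ K ⊗_B A`. -/
noncomputable abbrev derivedToBaseChange (K : CochainComplex (ModuleCat.{u} B) ℤ)
    (hK : ProjectiveModels.boundedAbove _ K) :
    E.derivedBaseChange.obj (ProjectiveModels.toMinus K hK) ⟶
      DerivedCategory.Q.obj (E.baseChangeC.obj K) :=
  ProjectiveModels.fromLeftDerivedMinus E.baseChange K hK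

end

end

end SplitSqZeroExtension
/-!
The class `θ_K` is natural in `K` and vanishes on admissible complexes, so a morphism from an
admissible complex to `K` which is invertible, or merely split, after passing to `K ⊗_B A` forces
`θ_K = 0`.

Conversely, `θ_K` is the obstruction to lifting the extension class `K ⊗_B A ⟶ (I K)[1]` of `K`
through `I ⊗ (K ⊗_B A) ⟶ I K`. If it vanishes, a lift composed with a projective resolution
`Y ⟶ K ⊗_B A` is a cocycle `c : Y ⟶ (I ⊗ Y)[1]`. Twisting the differential of `B ⊗_A Y` by `c`
gives a complex `S` of projective `B`-modules with `S ⊗_B A = Y`, and the null-homotopies lift `Y ⟶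
K ⊗_B A` to a morphism `f : S ⟶ K`. A truncation of `S` is a bounded admissible complex. If `T` is
the kernel of `I ⊗ Y ⟶ S ⟶ K`, then `S / T ⟶ K` and `T ⟶ Tor¹_B(K, A)` are quasi-isomorphisms, so
`K ⊗ᴸ_B A` is the cone of a morphism `T ⊗ᴸ_B A ⟶ Y`, which vanishes because its composite with the
isomorphism `Y ⟶ K ⊗_B A` does. Finally `N ⊗ᴸ_B A`, for a complex `N` of `A`-modules, is computed by
the twist of `⨁ₚ (I^{⊗ p} ⊗ N)[p]` by the projection that forgets the summand `p = 0`.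
-/

namespace YonedaTwo

section TwoOutOfThree

variable {C : Type u} [Category.{v} C] [Abelian C] {S₁ S₂ : ShortComplex (CochainComplex C ℤ)}
  (φ : S₁ ⟶ S₂)

lemma quasiIso_τ₂ (hS₁ : S₁.ShortExact) (hS₂ : S₂.ShortExact) [QuasiIso φ.τ₁]
    [QuasiIso φ.τ₃] : QuasiIso φ.τ₂ := by
  have := HasDerivedCategory.standard C
  rw [← DerivedCategory.isIso_Q_map_iff_quasiIso]
  exact Pretriangulated.isIso₂_of_isIso₁₃ (DerivedCategory.triangleOfSES.map hS₁ hS₂ φ)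
    (DerivedCategory.triangleOfSES_distinguished hS₁)
    (DerivedCategory.triangleOfSES_distinguished hS₂)
    (inferInstanceAs (IsIso (DerivedCategory.Q.map φ.τ₁)))
    (inferInstanceAs (IsIso (DerivedCategory.Q.map φ.τ₃)))

lemma quasiIso_τ₁ (hS₁ : S₁.ShortExact) (hS₂ : S₂.ShortExact) [QuasiIso φ.τ₂]
    [QuasiIso φ.τ₃] : QuasiIso φ.τ₁ := by
  have := HasDerivedCategory.standard C
  rw [← DerivedCategory.isIso_Q_map_iff_quasiIso]
  exact Pretriangulated.isIso₁_of_isIso₂₃ (DerivedCategory.triangleOfSES.map hS₁ hS₂ φ)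
    (DerivedCategory.triangleOfSES_distinguished hS₁)
    (DerivedCategory.triangleOfSES_distinguished hS₂)
    (inferInstanceAs (IsIso (DerivedCategory.Q.map φ.τ₂)))
    (inferInstanceAs (IsIso (DerivedCategory.Q.map φ.τ₃)))

lemma isZero_Q_obj [HasDerivedCategory.{w} C] {K : CochainComplex C ℤ} (hK : K.Acyclic) :
    IsZero (DerivedCategory.Q.obj K) := by
  have : QuasiIso (0 : K ⟶ K) := by
    rw [quasiIso_iff]
    intro i
    rw [quasiIsoAt_iff_exactAt _ _ (hK i)]
    exact hK i
  have h : IsIso (DerivedCategory.Q.map (0 : K ⟶ K)) := inferInstance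
  rw [Functor.map_zero] at h
  rw [IsZero.iff_id_eq_zero, ← cancel_epi (0 : DerivedCategory.Q.obj K ⟶ _)]
  simp

lemma quasiIso_f {S : ShortComplex (CochainComplex C ℤ)} (hS : S.ShortExact)
    (h : S.X₃.Acyclic) : QuasiIso S.f := by
  have := HasDerivedCategory.standard C
  rw [← DerivedCategory.isIso_Q_map_iff_quasiIso]
  exact (Pretriangulated.Triangle.isZero₃_iff_isIso₁ _
    (DerivedCategory.triangleOfSES_distinguished hS)).1 (isZero_Q_obj h)

end TwoOutOfThree

section FourTerm

variable {C : Type u} [Category.{v} C] [Abelian C]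
  {T J S F T' J' S' F' : CochainComplex C ℤ}
  {t : T ⟶ J} {m : J ⟶ S} {e : S ⟶ F} {htm : t ≫ m = 0} {hme : m ≫ e = 0}
  {t' : T' ⟶ J'} {m' : J' ⟶ S'} {e' : S' ⟶ F'} {htm' : t' ≫ m' = 0} {hme' : m' ≫ e' = 0}
  {τ : T ⟶ T'} {j : J ⟶ J'} {s : S ⟶ S'} {f : F ⟶ F'}
  (ht : t ≫ j = τ ≫ t') (hm : m ≫ s = j ≫ m') (he : e ≫ f = s ≫ e')

/-- The first short exact sequence into which an exact sequence with four terms splits. -/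
noncomputable abbrev leftSequence (htm : t ≫ m = 0) (hme : m ≫ e = 0) :
    ShortComplex (CochainComplex C ℤ) :=
  .mk t (kernel.lift e m hme) (by rw [← cancel_mono (kernel.ι e)]; simpa using htm)

/-- The second short exact sequence into which an exact sequence with four terms splits. -/
noncomputable abbrev rightSequence (e : S ⟶ F) : ShortComplex (CochainComplex C ℤ) :=
  .mk (kernel.ι e) e (kernel.condition e)

/-- The morphism of first short exact sequences induced by a morphism of exact sequences with four
terms. -/
noncomputable def leftMap : leftSequence htm hme ⟶ leftSequence htm' hme' where
  τ₁ := τ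
  τ₂ := j
  τ₃ := kernel.map e e' s f he
  comm₁₂ := ht.symm
  comm₂₃ := by simp [← cancel_mono (kernel.ι e'), hm]

/-- The morphism of second short exact sequences induced by a morphism of exact sequences with four
terms. -/
noncomputable def rightMap : rightSequence e ⟶ rightSequence e' where
  τ₁ := kernel.map e e' s f he
  τ₂ := s
  τ₃ := f
  comm₂₃ := he.symm

variable [Mono t] [Epi e] [Mono t'] [Epi e']
  (h₁ : (ShortComplex.mk t m htm).Exact) (h₂ : (ShortComplex.mk m e hme).Exact)
  (h₁' : (ShortComplex.mk t' m' htm').Exact) (h₂' : (ShortComplex.mk m' e' hme').Exact)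

include h₁ h₂ h₁' h₂' ht hm he in
lemma quasiIso_first_iff_third [QuasiIso j] [QuasiIso f] : QuasiIso τ ↔ QuasiIso s := by
  have hl := left_shortExact t m e htm hme h₁ h₂
  have hl' := left_shortExact t' m' e' htm' hme' h₁' h₂'
  let φ : leftSequence htm hme ⟶ leftSequence htm' hme' := leftMap ht hm he
  let ψ : rightSequence e ⟶ rightSequence e' := rightMap he
  have : QuasiIso φ.τ₂ := by assumption
  have : QuasiIso ψ.τ₃ := by assumption
  constructor
  · intro hτ
    have : QuasiIso ψ.τ₁ :=
      HomologicalComplex.HomologySequence.quasiIso_τ₃ φ hl hl' hτ inferInstance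
    exact quasiIso_τ₂ ψ (right_shortExact e) (right_shortExact e')
  · intro hs
    have : QuasiIso ψ.τ₂ := hs
    have : QuasiIso φ.τ₃ := quasiIso_τ₁ ψ (right_shortExact e) (right_shortExact e')
    exact quasiIso_τ₁ φ hl hl'

variable [HasDerivedCategory.{w} C]

include ht hm he in
lemma extClass_naturality :
    DerivedCategory.Q.map f ≫ extClass t' m' e' htm' hme' h₁' h₂' =
      extClass t m e htm hme h₁ h₂ ≫ (DerivedCategory.Q.map τ)⟦(2 : ℤ)⟧' := by
  have right := DerivedCategory.triangleOfSESδ_naturality (right_shortExact e)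
    (right_shortExact e') (rightMap he)
  have left := DerivedCategory.triangleOfSESδ_naturality
    (left_shortExact t m e htm hme h₁ h₂) (left_shortExact t' m' e' htm' hme' h₁' h₂')
    (leftMap (htm := htm) (htm' := htm') ht hm he)
  have shift := (shiftFunctorAdd' (DerivedCategory C) (1 : ℤ) 1 2 (by norm_num)).inv.naturality
    (DerivedCategory.Q.map τ)
  dsimp only [leftMap, rightMap, Functor.comp_map] at left right shift
  simp only [extClass, Category.assoc]
  rw [← shift, ← reassoc_of% right, ← Functor.map_comp_assoc, ← Functor.map_comp_assoc, left]

variable {h₁ h₂} in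
lemma exists_factor_of_extClass_eq_zero (h : extClass t m e htm hme h₁ h₂ = 0) :
    ∃ a : DerivedCategory.Q.obj F ⟶ (DerivedCategory.Q.obj J)⟦(1 : ℤ)⟧,
      DerivedCategory.triangleOfSESδ (right_shortExact e) =
        a ≫ (DerivedCategory.Q.map (kernel.lift e m hme))⟦(1 : ℤ)⟧' := by
  let δ₁ := DerivedCategory.triangleOfSESδ (left_shortExact t m e htm hme h₁ h₂)
  let δ₂ := DerivedCategory.triangleOfSESδ (right_shortExact e)
  have shifted := Pretriangulated.rot_of_distTriang _ (Pretriangulated.rot_of_distTriang _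
    (Pretriangulated.rot_of_distTriang _ (DerivedCategory.triangleOfSES_distinguished
      (left_shortExact t m e htm hme h₁ h₂))))
  have δ₂_comp_δ₁ : δ₂ ≫ δ₁⟦(1 : ℤ)⟧' = 0 := by
    refine (cancel_mono ((shiftFunctorAdd' (DerivedCategory C) (1 : ℤ) 1 2 (by norm_num)).inv.app
      (DerivedCategory.Q.obj T))).1 ?_
    exact (Category.assoc _ _ _).trans (h.trans zero_comp.symm)
  obtain ⟨g, hg⟩ := Pretriangulated.Triangle.coyoneda_exact₃ _ shifted δ₂
    ((Preadditive.comp_neg _ _).trans (neg_eq_zero.2 δ₂_comp_δ₁))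
  exact ⟨-g, hg.trans ((Preadditive.comp_neg _ _).trans (Preadditive.neg_comp _ _).symm)⟩

end FourTerm

end YonedaTwo

namespace ProjectiveModels

section Resolutions

open CochainComplex HomComplex ZeroObject

variable {C : Type u} [Category.{v} C] [Abelian C]

lemma isStrictlyLE_map {D : Type*} [Category* D] [Abelian D] (F : C ⥤ D) [F.Additive]
    (K : CochainComplex C ℤ) (b : ℤ) [K.IsStrictlyLE b] :
    IsStrictlyLE ((F.mapHomologicalComplex (.up ℤ)).obj K) b := by
  rw [isStrictlyLE_iff]
  exact fun i hi => F.map_isZero (K.isZero_of_isStrictlyLE b i hi)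

lemma isStrictlyLE_mappingCone {K L : CochainComplex C ℤ} (f : K ⟶ L) (b : ℤ)
    [K.IsStrictlyLE b] [L.IsStrictlyLE b] : (mappingCone f).IsStrictlyLE b := by
  rw [isStrictlyLE_iff]
  intro i hi
  rw [mappingCone.isZero_X_iff]
  exact ⟨K.isZero_of_isStrictlyLE b _ (by lia), L.isZero_of_isStrictlyLE b _ (by lia)⟩

lemma projective_mappingCone_X {K L : CochainComplex C ℤ} (f : K ⟶ L)
    (hK : ∀ n, Projective (K.X n)) (hL : ∀ n, Projective (L.X n)) (n : ℤ) :
    Projective ((mappingCone f).X n) := by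
  have := hK (n + 1)
  have := hL n
  exact Projective.of_iso (HomologicalComplex.homotopyCofiber.XIsoBiprod f n (n + 1) rfl).symm
    inferInstance

lemma acyclic_mappingCone_id (K : CochainComplex C ℤ) : (mappingCone (𝟙 K)).Acyclic := by
  intro n
  rw [HomologicalComplex.exactAt_iff_isZero_homology, IsZero.iff_id_eq_zero]
  simpa using (mappingCone.homotopyToZeroOfId K).homologyMap_eq n

lemma isStrictlyLE_biprod (K L : CochainComplex C ℤ) (b : ℤ) [K.IsStrictlyLE b]
    [L.IsStrictlyLE b] : (K ⊞ L).IsStrictlyLE b := by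
  rw [isStrictlyLE_iff]
  intro i hi
  exact ((biprod_isZero_iff _ _).2 ⟨K.isZero_of_isStrictlyLE b i hi,
    L.isZero_of_isStrictlyLE b i hi⟩).of_iso (HomologicalComplex.biprodXIso K L i)

lemma projective_biprod_X {K L : CochainComplex C ℤ} (hK : ∀ n, Projective (K.X n))
    (hL : ∀ n, Projective (L.X n)) (n : ℤ) : Projective ((K ⊞ L).X n) := by
  have := hK n
  have := hL n
  exact Projective.of_iso (HomologicalComplex.biprodXIso K L n).symm inferInstance

lemma quasiIso_biprod_inl (K : CochainComplex C ℤ) {D : CochainComplex C ℤ} (hD : D.Acyclic) :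
    QuasiIso (biprod.inl : K ⟶ K ⊞ D) :=
  YonedaTwo.quasiIso_f (S := .mk biprod.inl biprod.snd biprod.inl_snd)
    (ShortComplex.Splitting.ofHasBinaryBiproduct K D).shortExact hD

lemma epi_f_of_quasiIso {K L : CochainComplex C ℤ} (f : K ⟶ L) [QuasiIso f] (m n p : ℤ)
    (hm : m + 1 = n) (hp : n + 1 = p) [Epi (f.f m)] (hL : IsZero (L.X p)) : Epi (f.f n) := by
  rw [epi_iff_surjective_up_to_refinements]
  intro T y
  have epi_homology : Epi (HomologicalComplex.homologyMap f n) := inferInstance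
  rw [HomologicalComplex.epi_homologyMap_iff_up_to_refinements f m n p (by simp; lia)
    (by simp; lia)] at epi_homology
  obtain ⟨T', π, _, x, _, z, hz⟩ := epi_homology y (hL.eq_of_tgt _ _)
  obtain ⟨T'', π', _, w, hw⟩ := surjective_up_to_refinements_of_epi (f.f m) z
  refine ⟨T'', π' ≫ π, inferInstance, π' ≫ x + w ≫ K.d m n, ?_⟩
  rw [Category.assoc, hz, Preadditive.comp_add, reassoc_of% hw]
  simp

variable [EnoughProjectives C]

lemma exists_epi_cochain (K : CochainComplex C ℤ) (b : ℤ) :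
    ∃ (X : CochainComplex C ℤ) (h : Cochain X K (-1)),
      (∀ n, Projective (X.X n)) ∧ X.IsStrictlyLE b ∧ ∀ n m hnm, n ≤ b → Epi (h.v n m hnm) := by
  let X : CochainComplex C ℤ :=
    { X n := if n ≤ b then Projective.over (K.X (n - 1)) else 0
      d _ _ := 0 }
  let h : Cochain X K (-1) := Cochain.mk fun n m hnm =>
    if hn : n ≤ b then eqToHom (if_pos hn) ≫ Projective.π (K.X (n - 1)) ≫
      eqToHom (by rw [show n - 1 = m by lia]) else 0
  refine ⟨X, h, fun n => ?_, ?_, fun n m hnm hn => ?_⟩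
  · dsimp only [X]
    split_ifs <;> infer_instance
  · rw [isStrictlyLE_iff]
    intro i hi
    dsimp only [X]
    rw [if_neg (by lia)]
    exact isZero_zero C
  · dsimp only [h]
    rw [Cochain.mk_v, dif_pos hn]
    infer_instance

lemma exists_contractible_projective (K : CochainComplex C ℤ) (b : ℤ) :
    ∃ (D : CochainComplex C ℤ) (d : D ⟶ K), D.Acyclic ∧ (∀ n, Projective (D.X n)) ∧
      D.IsStrictlyLE b ∧ ∀ n < b, Epi (d.f n) := by
  obtain ⟨X, h, hX, hXb, epi_h⟩ := exists_epi_cochain K b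
  let d : mappingCone (𝟙 X) ⟶ K := mappingCone.desc (𝟙 X) h
    (Cocycle.homOf (Cocycle.mk (δ (-1) 0 h) 1 (by omega) (by rw [δ_δ]))) (by simp)
  refine ⟨_, d, acyclic_mappingCone_id X, projective_mappingCone_X _ hX hX,
    isStrictlyLE_mappingCone _ b, fun n hn => ?_⟩
  have fac : (mappingCone.inl (𝟙 X)).v (n + 1) n (by omega) ≫ d.f n =
      h.v (n + 1) n (by omega) := by simp [d]
  have := epi_h (n + 1) n (by omega) (by omega)
  exact epi_of_epi_fac fac

lemma exists_projective_epi (K : CochainComplex C ℤ) (b : ℤ) [K.IsStrictlyLE b] :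
    ∃ (P : CochainComplex C ℤ) (p : P ⟶ K), QuasiIso p ∧ (∀ n, Projective (P.X n)) ∧
      P.IsStrictlyLE b ∧ Epi p := by
  obtain ⟨P, p, _, hP, _⟩ := exists_projective K b
  obtain ⟨D, d, hD, hD', _, epi_d⟩ := exists_contractible_projective K b
  have := quasiIso_biprod_inl P hD
  have : QuasiIso (biprod.desc p d) :=
    quasiIso_of_comp_left (biprod.inl : P ⟶ P ⊞ D) _ (hφφ' := by rwa [biprod.inl_desc])
  have epi_of_lt (n : ℤ) (hn : n < b) : Epi ((biprod.desc p d).f n) := by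
    have := epi_d n hn
    exact epi_of_epi_fac (congr_arg (fun f => f.f n) (biprod.inr_desc p d))
  refine ⟨P ⊞ D, biprod.desc p d, this, projective_biprod_X hP hD', isStrictlyLE_biprod P D b,
    HomologicalComplex.epi_of_epi_f _ fun n => ?_⟩
  obtain hn | rfl | hn := lt_trichotomy n b
  · exact epi_of_lt n hn
  · have := epi_of_lt (n - 1) (by lia)
    exact epi_f_of_quasiIso _ (n - 1) n (n + 1) (by lia) rfl
      (K.isZero_of_isStrictlyLE n (n + 1) (by lia))
  · exact ⟨fun _ _ _ => (K.isZero_of_isStrictlyLE b n hn).eq_of_src _ _⟩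

end Resolutions

section

variable {C : Type u} [Category.{v} C] [Abelian C]

lemma isKProjective_of_boundedAbove {P : CochainComplex C ℤ} (hP : boundedAbove C P)
    (hP' : ∀ n, Projective (P.X n)) : P.IsKProjective := by
  obtain ⟨b, hb⟩ := hP
  exact CochainComplex.isKProjective_of_projective P b

end

section

variable {C : Type u} [Category.{v} C] [Abelian C] [HasDerivedCategory.{w} C]
  {D : Type*} [Category* D] [Abelian D] [HasDerivedCategory.{w'} D]
  (F : C ⥤ D) [F.Additive]

lemma isIso_of_isIso_Qh_map {P P' : CochainComplex C ℤ} [P.IsKProjective] [P'.IsKProjective]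
    (f : (HomotopyCategory.quotient C (.up ℤ)).obj P ⟶ (HomotopyCategory.quotient C (.up ℤ)).obj P')
    [IsIso (DerivedCategory.Qh.map f)] : IsIso f := by
  obtain ⟨g, hg⟩ := (CochainComplex.IsKProjective.Qh_map_bijective P' _).surjective
    (inv (DerivedCategory.Qh.map f))
  exact ⟨g, (CochainComplex.IsKProjective.Qh_map_bijective P _).injective (by simp [hg]),
    (CochainComplex.IsKProjective.Qh_map_bijective P' _).injective (by simp [hg])⟩

lemma exists_map_eq {P : CochainComplex C ℤ} [P.IsKProjective] {L : CochainComplex C ℤ}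
    (f : DerivedCategory.Q.obj P ⟶ DerivedCategory.Q.obj L) :
    ∃ g : P ⟶ L, DerivedCategory.Q.map g = f := by
  obtain ⟨g, hg⟩ := (CochainComplex.IsKProjective.Qh_map_bijective P
    ((HomotopyCategory.quotient C (.up ℤ)).obj L)).surjective
      ((DerivedCategory.quotientCompQhIso C).hom.app P ≫ f ≫
        (DerivedCategory.quotientCompQhIso C).inv.app L)
  obtain ⟨g, rfl⟩ := (HomotopyCategory.quotient C (.up ℤ)).map_surjective g
  refine ⟨g, ?_⟩
  rw [← cancel_epi ((DerivedCategory.quotientCompQhIso C).hom.app P),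
    ← (DerivedCategory.quotientCompQhIso C).hom.naturality]
  simp [hg]

lemma homotopy_of_Q_map_eq {P : CochainComplex C ℤ} [P.IsKProjective] {L : CochainComplex C ℤ}
    (f g : P ⟶ L) (h : DerivedCategory.Q.map f = DerivedCategory.Q.map g) :
    Nonempty (Homotopy f g) := by
  refine ⟨HomotopyCategory.homotopyOfEq _ _
    ((CochainComplex.IsKProjective.Qh_map_bijective P _).injective ?_)⟩
  have h₁ := (DerivedCategory.quotientCompQhIso C).hom.naturality f
  have h₂ := (DerivedCategory.quotientCompQhIso C).hom.naturality g
  rw [h, ← h₂, cancel_mono] at h₁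
  exact h₁

lemma Model.isIso_lift {K : CochainComplex C ℤ} [K.IsKProjective]
    (M : Model (DerivedCategory.Q.obj K)) :
    IsIso (M.lift (L := (HomotopyCategory.quotient C (.up ℤ)).obj K)
      ((DerivedCategory.quotientCompQhIso C).inv.app K)) := by
  have := M.isKProjective
  have h := M.Qh_map_lift (L := (HomotopyCategory.quotient C (.up ℤ)).obj K)
    ((DerivedCategory.quotientCompQhIso C).inv.app K)
  have : IsIso (DerivedCategory.Qh.map (M.lift (L := (HomotopyCategory.quotient C (.up ℤ)).obj K)
      ((DerivedCategory.quotientCompQhIso C).inv.app K))) := by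
    rw [h]
    exact IsIso.comp_isIso' inferInstance
      (inferInstanceAs (IsIso ((DerivedCategory.quotientCompQhIso C).inv.app K)))
  exact isIso_of_isIso_Qh_map _

lemma Model.lift_naturality {K L : CochainComplex C ℤ} (f : K ⟶ L)
    (M : Model (DerivedCategory.Q.obj K)) (N : Model (DerivedCategory.Q.obj L)) :
    M.lift (DerivedCategory.Q.map f ≫ N.iso.inv) ≫
      N.lift (L := (HomotopyCategory.quotient C (.up ℤ)).obj L)
        ((DerivedCategory.quotientCompQhIso C).inv.app L) =
      M.lift (L := (HomotopyCategory.quotient C (.up ℤ)).obj K)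
        ((DerivedCategory.quotientCompQhIso C).inv.app K) ≫
        (HomotopyCategory.quotient C (.up ℤ)).map f := by
  refine M.hom_ext ?_
  rw [Functor.map_comp, Functor.map_comp, Model.Qh_map_lift, Model.Qh_map_lift,
    Model.Qh_map_lift]
  simp only [Category.assoc, Iso.inv_hom_id_assoc]
  congr 1
  exact (DerivedCategory.quotientCompQhIso C).inv.naturality f

variable [EnoughProjectives C]

lemma nonempty_leftDerivedMinus_obj_iso (X : DerivedCategory.Minus C) {P : CochainComplex C ℤ}
    (hP : boundedAbove C P) (hP' : ∀ n, Projective (P.X n))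
    (e : X.obj ≅ DerivedCategory.Q.obj P) :
    Nonempty ((leftDerivedMinus F).obj X ≅
      DerivedCategory.Q.obj ((F.mapHomologicalComplex (.up ℤ)).obj P)) := by
  have := isKProjective_of_boundedAbove hP hP'
  have := (model X).isKProjective
  let f := (model X).lift (e.hom ≫ (DerivedCategory.quotientCompQhIso C).inv.app P)
  have : IsIso (DerivedCategory.Qh.map f) := by
    rw [Model.Qh_map_lift]
    infer_instance
  have := isIso_of_isIso_Qh_map f
  exact ⟨DerivedCategory.Qh.mapIso ((F.mapHomotopyCategory (.up ℤ)).mapIso (asIso f)) ≪≫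
    DerivedCategory.Qh.mapIso ((F.mapHomotopyCategoryFactors (.up ℤ)).app P) ≪≫
      (DerivedCategory.quotientCompQhIso D).app ((F.mapHomologicalComplex (.up ℤ)).obj P)⟩

lemma isIso_fromLeftDerivedMinus {P : CochainComplex C ℤ}
    (hP : boundedAbove C P) (hP' : ∀ n, Projective (P.X n)) :
    IsIso (fromLeftDerivedMinus F P hP) := by
  have := isKProjective_of_boundedAbove hP hP'
  have := Model.isIso_lift (K := P) (model (toMinus P hP))
  exact IsIso.comp_isIso' (DerivedCategory.Qh.mapIso
    ((F.mapHomotopyCategory (.up ℤ)).mapIso (@asIso _ _ _ _ _ this))).isIso_hom inferInstance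

/-- The morphism of `D⁻` given by a morphism of complexes. -/
noncomputable def toMinusMap {K L : CochainComplex C ℤ} (f : K ⟶ L) (hK : boundedAbove C K)
    (hL : boundedAbove C L) : toMinus K hK ⟶ toMinus L hL :=
  ObjectProperty.homMk (DerivedCategory.Q.map f)

lemma fromLeftDerivedMinus_naturality {K L : CochainComplex C ℤ} (f : K ⟶ L)
    (hK : boundedAbove C K) (hL : boundedAbove C L) :
    (leftDerivedMinus F).map (toMinusMap f hK hL) ≫ fromLeftDerivedMinus F L hL =
      fromLeftDerivedMinus F K hK ≫
        DerivedCategory.Q.map ((F.mapHomologicalComplex (.up ℤ)).map f) := by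
  have h : (model (toMinus K hK)).lift ((toMinusMap f hK hL).hom ≫
        (model (toMinus L hL)).iso.inv) ≫
      (model (toMinus L hL)).lift ((DerivedCategory.quotientCompQhIso C).inv.app L) =
      (model (toMinus K hK)).lift ((DerivedCategory.quotientCompQhIso C).inv.app K) ≫
        (HomotopyCategory.quotient C (.up ℤ)).map f :=
    Model.lift_naturality f (model (toMinus K hK)) (model (toMinus L hL))
  dsimp only [fromLeftDerivedMinus, leftDerivedMinus]
  rw [← Functor.map_comp_assoc, ← Functor.map_comp, h]
  simp only [Functor.map_comp, Category.assoc]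
  congr 1
  rw [← Functor.map_comp_assoc]
  erw [(F.mapHomotopyCategoryFactors (.up ℤ)).hom.naturality f]
  rw [Functor.map_comp_assoc]
  congr 1
  exact (DerivedCategory.quotientCompQhIso D).hom.naturality _

instance isIso_toMinusMap {K L : CochainComplex C ℤ} (f : K ⟶ L) [QuasiIso f]
    (hK : boundedAbove C K) (hL : boundedAbove C L) : IsIso (toMinusMap f hK hL) := by
  have : IsIso ((DerivedCategory.Minus.ι (C := C)).map (toMinusMap f hK hL)) :=
    inferInstanceAs (IsIso (DerivedCategory.Q.map f))
  exact isIso_of_reflects_iso _ (DerivedCategory.Minus.ι (C := C))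

end

end ProjectiveModels

namespace Truncation

open CochainComplex

section

variable {C : Type*} [Category* C] [Abelian C]

lemma exists_πTruncGE_comp_eq {S L : CochainComplex C ℤ} (f : S ⟶ L) (c : ℤ) [L.IsStrictlyGE c] :
    ∃ g, S.πTruncGE c ≫ g = f :=
  ⟨truncGEMap f c ≫ inv (L.πTruncGE c), by
    rw [πTruncGE_naturality_assoc, IsIso.hom_inv_id, Category.comp_id]⟩

instance epi_πTruncGE (S : CochainComplex C ℤ) (c : ℤ) : Epi (S.πTruncGE c) :=
  inferInstanceAs (Epi (HomologicalComplex.πTruncGE S (ComplexShape.embeddingUpIntGE c)))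

lemma isStrictlyLE_of_epi {S L : CochainComplex C ℤ} (f : S ⟶ L) [Epi f] (b : ℤ)
    [S.IsStrictlyLE b] : L.IsStrictlyLE b := by
  rw [isStrictlyLE_iff]
  exact fun i hi => IsZero.of_epi (f.f i) (S.isZero_of_isStrictlyLE b i hi)

lemma isStrictlyGE_map {D : Type*} [Category* D] [Abelian D] (F : C ⥤ D) [F.Additive]
    (S : CochainComplex C ℤ) (c : ℤ) [S.IsStrictlyGE c] :
    IsStrictlyGE ((F.mapHomologicalComplex (.up ℤ)).obj S) c := by
  rw [isStrictlyGE_iff]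
  exact fun i hi => F.map_isZero (S.isZero_of_isStrictlyGE c i hi)

end

section Adjunction

variable {C D : Type*} [Category* C] [Category* D] [Abelian C] [Abelian D]
  {F : C ⥤ D} {G : D ⥤ C} [F.Additive] [G.Additive] (adj : F ⊣ G)

include adj

-- The adjunction extends to complexes and both adjoints preserve complexes in degrees `≥ c`, so
-- `F S ⟶ F (τ S)` and `F S ⟶ τ (F S)` factor through each other.
lemma quasiIso_map_πTruncGE (S : CochainComplex C ℤ) (c : ℤ)
    [IsGE ((F.mapHomologicalComplex (.up ℤ)).obj S) c] :
    QuasiIso ((F.mapHomologicalComplex (.up ℤ)).map (S.πTruncGE c)) := by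
  let FC : CochainComplex C ℤ ⥤ CochainComplex D ℤ := F.mapHomologicalComplex (.up ℤ)
  let GC : CochainComplex D ℤ ⥤ CochainComplex C ℤ := G.mapHomologicalComplex (.up ℤ)
  let η (K : CochainComplex C ℤ) : K ⟶ GC.obj (FC.obj K) :=
    (NatTrans.mapHomologicalComplex adj.unit (.up ℤ)).app K
  let ε (L : CochainComplex D ℤ) : FC.obj (GC.obj L) ⟶ L :=
    (NatTrans.mapHomologicalComplex adj.counit (.up ℤ)).app L
  have triangle (K : CochainComplex C ℤ) : FC.map (η K) ≫ ε (FC.obj K) = 𝟙 _ := by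
    ext n
    exact adj.left_triangle_components (K.X n)
  have counit_naturality {L L' : CochainComplex D ℤ} (f : L ⟶ L') :
      FC.map (GC.map f) ≫ ε L' = ε L ≫ f :=
    (NatTrans.mapHomologicalComplex adj.counit (.up ℤ)).naturality f
  have := isStrictlyGE_map F (S.truncGE c) c
  have := isStrictlyGE_map G (truncGE (FC.obj S) c) c
  obtain ⟨ψ, hψ⟩ := exists_πTruncGE_comp_eq (FC.map (S.πTruncGE c)) c
  obtain ⟨g, hg⟩ := exists_πTruncGE_comp_eq (η S ≫ GC.map (πTruncGE (FC.obj S) c)) c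
  have hφ : FC.map (S.πTruncGE c) ≫ FC.map g ≫ ε _ = πTruncGE (FC.obj S) c := by
    rw [← Functor.map_comp_assoc, hg, Functor.map_comp_assoc, counit_naturality,
      reassoc_of% triangle S]
  have : F.IsLeftAdjoint := adj.isLeftAdjoint
  have : Epi (FC.map (S.πTruncGE c)) :=
    HomologicalComplex.epi_of_epi_f _ fun n => inferInstanceAs (Epi (F.map ((S.πTruncGE c).f n)))
  have : IsIso ψ := ⟨FC.map g ≫ ε _, by
    rw [← cancel_epi (πTruncGE (FC.obj S) c), reassoc_of% hψ, hφ, Category.comp_id], by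
    rw [← cancel_epi (FC.map (S.πTruncGE c)), Category.assoc, reassoc_of% hφ, hψ,
      Category.comp_id]⟩
  rw [← hψ]
  exact inferInstance

end Adjunction

end Truncation

namespace MappingCone

lemma acyclic_mappingCone_iff {C : Type*} [Category* C] [Abelian C] {K L : CochainComplex C ℤ}
    (f : K ⟶ L) : (CochainComplex.mappingCone f).Acyclic ↔ QuasiIso f := by
  have h := (HomotopyCategory.subcategoryAcyclic C).trW_iff_of_distinguished _
    (HomotopyCategory.mappingCone_triangleh_distinguished f)
  rw [← HomotopyCategory.quasiIso_eq_trW_subcategoryAcyclic] at h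
  rw [← HomotopyCategory.quotient_obj_mem_subcategoryAcyclic_iff_acyclic]
  exact h.symm.trans (HomotopyCategory.quotient_map_mem_quasiIso_iff f)

lemma acyclic_map_mappingCone_iff {C D : Type*} [Category* C] [Category* D] [Abelian C] [Abelian D]
    (F : C ⥤ D) [F.Additive] {K L : CochainComplex C ℤ} (f : K ⟶ L) :
    ((F.mapHomologicalComplex (.up ℤ)).obj (CochainComplex.mappingCone f)).Acyclic ↔
      QuasiIso ((F.mapHomologicalComplex (.up ℤ)).map f) := by
  rw [← acyclic_mappingCone_iff]
  exact forall_congr' fun n =>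
    exactAt_iff_of_quasiIsoAt (CochainComplex.mappingCone.mapHomologicalComplexIso f F).hom n

variable {C : Type*} [Category* C] [Abelian C] [HasDerivedCategory.{w} C]

lemma nonempty_Q_mappingCone_iso {S : ShortComplex (CochainComplex C ℤ)} (hS : S.ShortExact)
    {P : CochainComplex C ℤ} (g : P ⟶ S.X₁) [QuasiIso g] :
    Nonempty (DerivedCategory.Q.obj (CochainComplex.mappingCone (g ≫ S.f)) ≅
      DerivedCategory.Q.obj S.X₃) :=
  ⟨Pretriangulated.Triangle.π₃.mapIso (Pretriangulated.isoTriangleOfIso₁₂ _ _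
    (DerivedCategory.mappingCone_triangle_distinguished (g ≫ S.f))
    (DerivedCategory.triangleOfSES_distinguished hS)
    (asIso (DerivedCategory.Q.map g) :) (Iso.refl _)
    ((Category.comp_id _).trans (Functor.map_comp _ _ _)))⟩

lemma nonempty_Q_mappingCone_iso_biprod {P L : CochainComplex C ℤ} (g : P ⟶ L)
    (hg : DerivedCategory.Q.map g = 0) :
    Nonempty (DerivedCategory.Q.obj (CochainComplex.mappingCone g) ≅
      DerivedCategory.Q.obj L ⊞ (DerivedCategory.Q.obj P)⟦(1 : ℤ)⟧) := by
  have rotated := Pretriangulated.rot_of_distTriang _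
    (DerivedCategory.mappingCone_triangle_distinguished g)
  obtain ⟨e, -⟩ := Pretriangulated.exists_iso_binaryBiproduct_of_distTriang _ rotated (by
    change -(DerivedCategory.Q.map g)⟦(1 : ℤ)⟧' = 0
    rw [hg, Functor.map_zero, neg_zero])
  exact ⟨e⟩

end MappingCone

namespace ConnectingCocycle

open CochainComplex HomComplex

variable {C : Type u} [Category.{v} C]

lemma v_comp_d_add [Preadditive C] {K L : CochainComplex C ℤ} (c : Cocycle K L 1) {i j l : ℤ}
    (h : i + 1 = j) (h' : j + 1 = l) :
    c.1.v i j h ≫ L.d j l + K.d i j ≫ c.1.v j l h' = 0 := by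
  have h₀ := congr($(c.δ_eq_zero 2).v i l (by omega))
  rwa [δ_v 1 2 (by norm_num) c.1 i l (by omega) j j (by omega) h,
    Int.negOnePow_even 2 (by decide), one_smul] at h₀

variable [Abelian C] {S : ShortComplex (CochainComplex C ℤ)} (hS : S.ShortExact)
  {R : CochainComplex C ℤ}

include hS in
lemma exists_cocycle_comp_f {u : Cochain R S.X₂ 0} {ρ : R ⟶ S.X₃}
    (hu : u.comp (Cochain.ofHom S.g) (add_zero 0) = Cochain.ofHom ρ) :
    ∃ γ : Cocycle R S.X₁ 1, δ 0 1 u = γ.1.comp (Cochain.ofHom S.f) (add_zero 1) := by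
  have hex (n : ℤ) : (S.map (HomologicalComplex.eval _ _ n)).ShortExact :=
    hS.map_of_exact (HomologicalComplex.eval _ _ n)
  have (n : ℤ) : Mono (S.map (HomologicalComplex.eval _ _ n)).f := (hex n).mono_f
  have (n : ℤ) : Mono (S.f.f n) := this n
  have hδ : (δ 0 1 u).comp (Cochain.ofHom S.g) (add_zero 1) = 0 := by
    rw [← δ_comp_ofHom, hu, δ_ofHom]
  have hv (p q : ℤ) (hpq : p + 1 = q) : (δ 0 1 u).v p q hpq ≫ S.g.f q = 0 := by
    simpa using congr($(hδ).v p q hpq)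
  let γ : Cochain R S.X₁ 1 := Cochain.mk fun p q hpq =>
    (hex q).exact.lift ((δ 0 1 u).v p q hpq) (hv p q hpq)
  have hγ : γ.comp (Cochain.ofHom S.f) (add_zero 1) = δ 0 1 u := by
    ext p q hpq
    rw [Cochain.comp_zero_cochain_v, Cochain.ofHom_v]
    exact (hex q).exact.lift_f ((δ 0 1 u).v p q hpq) (hv p q hpq)
  have hγ' : (δ 1 2 γ).comp (Cochain.ofHom S.f) (add_zero 2) = 0 := by
    rw [← δ_comp_ofHom, hγ, δ_δ]
  refine ⟨Cocycle.mk γ 2 (by norm_num) ?_, hγ.symm⟩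
  ext p q hpq
  rw [← cancel_mono (S.f.f q)]
  simpa using congr($(hγ').v p q hpq)

include hS in
lemma exists_cochain_comp_g [∀ n, Projective (R.X n)] (ρ : R ⟶ S.X₃) :
    ∃ u : Cochain R S.X₂ 0, u.comp (Cochain.ofHom S.g) (add_zero 0) = Cochain.ofHom ρ := by
  have := hS.epi_g
  refine ⟨Cochain.ofHoms fun n => Projective.factorThru (ρ.f n) (S.g.f n), ?_⟩
  ext n
  simp

variable [HasDerivedCategory.{w} C]

lemma Q_map_triangleOfSESδ {ρ : R ⟶ S.X₃} {u : Cochain R S.X₂ 0} {γ : Cocycle R S.X₁ 1}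
    (hu : u.comp (Cochain.ofHom S.g) (add_zero 0) = Cochain.ofHom ρ)
    (hγ : δ 0 1 u = γ.1.comp (Cochain.ofHom S.f) (add_zero 1)) :
    DerivedCategory.Q.map ρ ≫ DerivedCategory.triangleOfSESδ hS =
      DerivedCategory.Q.map (Cocycle.equivHomShift.symm γ) ≫
        (DerivedCategory.Q.commShiftIso (1 : ℤ)).hom.app S.X₁ := by
  let l : R ⟶ mappingCone S.f := mappingCone.lift S.f (-γ) u (by
    rw [hγ, Cocycle.coe_neg, Cochain.neg_comp, add_neg_cancel])
  let p : mappingCone S.f ⟶ S.X₁⟦(1 : ℤ)⟧ := (mappingCone.triangle S.f).mor₃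
  have hρ : l ≫ mappingCone.descShortComplex S = ρ := by
    ext n
    have huₙ := congr($(hu).v n n (add_zero n))
    rw [Cochain.comp_zero_cochain_v, Cochain.ofHom_v, Cochain.ofHom_v] at huₙ
    refine (mappingCone.lift_desc_f (φ := S.f) (-γ) u _ _ _ _ n (n + 1) rfl).trans ?_
    rw [huₙ, Cochain.zero_v, comp_zero, zero_add]
  have hl : l ≫ p = Cocycle.equivHomShift.symm γ := by
    have hp : Cocycle.equivHomShift.symm (-mappingCone.fst S.f) = p := rfl
    rw [← hp, ← Cocycle.equivHomShift_symm_precomp]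
    congr 1
    ext p q hpq
    simp [l]
  rw [← hρ, Functor.map_comp, Category.assoc,
    DerivedCategory.descShortComplex_triangleOfSESδ hS, ← Category.assoc]
  congr 1
  exact (Functor.map_comp _ _ _).symm.trans (congr_arg _ hl)

omit [HasDerivedCategory.{w} C] in
lemma exists_eq_add_δ_of_homotopy {K L : CochainComplex C ℤ} {β γ : Cocycle K L 1}
    (H : Homotopy (Cocycle.equivHomShift.symm γ) (Cocycle.equivHomShift.symm β)) :
    ∃ z : Cochain K L 0, β.1 = γ.1 + δ 0 1 z := by
  obtain ⟨z, hz⟩ := Cochain.equivHomotopy _ _ H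
  have rightUnshift_ofHom (γ : Cocycle K L 1) :
      (Cochain.ofHom (Cocycle.equivHomShift.symm γ)).rightUnshift 1 (by norm_num) = γ.1 :=
    congr_arg Subtype.val (Cocycle.equivHomShift.apply_symm_apply γ)
  have unshifted := congr_arg (fun c => Cochain.rightUnshift c 1 (by norm_num)) hz
  rw [Cochain.rightUnshift_add, rightUnshift_ofHom, rightUnshift_ofHom] at unshifted
  refine ⟨z.rightUnshift 0 (by norm_num), ?_⟩
  rw [unshifted, Cochain.δ_rightUnshift z 0 (by norm_num) 1 0 (by norm_num)]
  simp

lemma exists_cochain_of_Q_map_triangleOfSESδ [∀ n, Projective (R.X n)] [R.IsKProjective]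
    (ρ : R ⟶ S.X₃) (β : Cocycle R S.X₁ 1)
    (h : DerivedCategory.Q.map ρ ≫ DerivedCategory.triangleOfSESδ hS =
      DerivedCategory.Q.map (Cocycle.equivHomShift.symm β) ≫
        (DerivedCategory.Q.commShiftIso (1 : ℤ)).hom.app S.X₁) :
    ∃ u : Cochain R S.X₂ 0, u.comp (Cochain.ofHom S.g) (add_zero 0) = Cochain.ofHom ρ ∧
      δ 0 1 u = β.1.comp (Cochain.ofHom S.f) (add_zero 1) := by
  obtain ⟨u, hu⟩ := exists_cochain_comp_g hS ρ
  obtain ⟨γ, hγ⟩ := exists_cocycle_comp_f hS hu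
  rw [Q_map_triangleOfSESδ hS hu hγ, cancel_mono] at h
  obtain ⟨H⟩ := ProjectiveModels.homotopy_of_Q_map_eq _ _ h
  obtain ⟨z, hz⟩ := exists_eq_add_δ_of_homotopy H
  refine ⟨u + z.comp (Cochain.ofHom S.f) (add_zero 0), ?_, ?_⟩
  · rw [Cochain.add_comp, hu, Cochain.comp_assoc_of_second_is_zero_cochain, ← Cochain.ofHom_comp,
      S.zero, Cochain.ofHom_zero, Cochain.comp_zero, add_zero]
  · rw [δ_add, δ_comp_ofHom, hγ, hz, Cochain.add_comp]

end ConnectingCocycle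

namespace CoproductTower

variable {C : Type*} [Category* C] [Preadditive C] (Y : ℕ → C) [HasCoproduct Y] (Φ : C ⥤ C)
  (e : ∀ p, Y (p + 1) ≅ Φ.obj (Y p))

/-- The projection of `Y₀ ⨿ Y₁ ⨿ ⋯` to the first factor. -/
noncomputable def fst : ∐ Y ⟶ Y 0 :=
  Sigma.desc fun
    | 0 => 𝟙 _
    | _ + 1 => 0

/-- The projection of `Y₀ ⨿ Y₁ ⨿ ⋯` to `Y₁ ⨿ Y₂ ⨿ ⋯`, identified with `Φ (Y₀ ⨿ Y₁ ⨿ ⋯)`. -/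
noncomputable def next : ∐ Y ⟶ Φ.obj (∐ Y) :=
  Sigma.desc fun
    | 0 => 0
    | p + 1 => (e p).hom ≫ Φ.map (Sigma.ι Y p)

lemma ι_fst : Sigma.ι Y 0 ≫ fst Y = 𝟙 _ :=
  Sigma.ι_desc ..

lemma ι_next : Sigma.ι Y 0 ≫ next Y Φ e = 0 :=
  Sigma.ι_desc ..

lemma exists_splitting [PreservesColimit (Discrete.functor Y) Φ] :
    ∃ σ : (ShortComplex.mk _ _ (ι_next Y Φ e)).Splitting, σ.r = fst Y := by
  have hc : IsColimit (Cofan.mk (Φ.obj (∐ Y)) fun p => Φ.map (Sigma.ι Y p)) :=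
    isColimitCofanMkObjOfIsColimit Φ _ _ (coproductIsCoproduct Y)
  let s : Φ.obj (∐ Y) ⟶ ∐ Y := Cofan.IsColimit.desc hc fun p => (e p).inv ≫ Sigma.ι Y (p + 1)
  have hs (p : ℕ) : Φ.map (Sigma.ι Y p) ≫ s = (e p).inv ≫ Sigma.ι Y (p + 1) :=
    Cofan.IsColimit.fac hc _ p
  refine ⟨⟨fst Y, s, ι_fst Y, Cofan.IsColimit.hom_ext hc _ _ fun p => ?_, ?_⟩, rfl⟩
  · change Φ.map (Sigma.ι Y p) ≫ s ≫ next Y Φ e = Φ.map (Sigma.ι Y p) ≫ 𝟙 _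
    rw [reassoc_of% (hs p)]
    simp [next]
  · ext p
    cases p with
    | zero => simp [fst, next]
    | succ p => simp [fst, next, hs]

lemma isStrictlyLE_coproduct {J : Type*} [HasColimitsOfShape (Discrete J) C]
    (Y : J → CochainComplex C ℤ) (b : ℤ) [∀ j, (Y j).IsStrictlyLE b] :
    (∐ Y).IsStrictlyLE b := by
  rw [CochainComplex.isStrictlyLE_iff]
  intro i hi
  rw [IsZero.iff_id_eq_zero]
  exact Cofan.IsColimit.hom_ext (isColimitCofanMkObjOfIsColimit (HomologicalComplex.eval _ _ i)
    _ _ (coproductIsCoproduct Y)) _ _ fun j =>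
      ((Y j).isZero_of_isStrictlyLE b i hi).eq_of_src _ _

end CoproductTower

namespace DistinguishedTriangle

variable {C : Type*} [Category* C] [Preadditive C] [HasZeroObject C] [HasShift C ℤ]
  [∀ n : ℤ, (shiftFunctor C n).Additive] [Pretriangulated C]

lemma isIso_mor₂_comp {T : Pretriangulated.Triangle C} (hT : T ∈ distTriang C)
    {S : ShortComplex C} (σ : S.Splitting) (e₂ : S.X₂ ≅ T.obj₃) (e₃ : S.X₃ ≅ T.obj₁⟦(1 : ℤ)⟧)
    (comm : e₂.hom ≫ T.mor₃ = S.g ≫ e₃.hom) : IsIso (T.mor₂ ≫ e₂.inv ≫ σ.r) := by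
  have : Epi S.g := σ.isSplitEpi_g.epi
  have : Epi (e₂.hom ≫ T.mor₃) := by rw [comm]; infer_instance
  have : Epi T.mor₃ := epi_of_epi e₂.hom T.mor₃
  have : Mono T.mor₂ := T.mono₂ hT (T.mor₁_eq_zero_of_epi₃ hT inferInstance)
  obtain ⟨j, hj⟩ := T.coyoneda_exact₃ hT (S.f ≫ e₂.hom) (by
    rw [Category.assoc, comm, S.zero_assoc, zero_comp])
  have mor₂_comp_g : T.mor₂ ≫ e₂.inv ≫ S.g = 0 := by
    rw [← cancel_mono e₃.hom, zero_comp, Category.assoc, Category.assoc, ← comm,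
      e₂.inv_hom_id_assoc, Pretriangulated.comp_distTriang_mor_zero₂₃ _ hT]
  refine ⟨j, ?_, ?_⟩
  · rw [← cancel_mono T.mor₂]
    simp only [Category.assoc, ← hj, Category.id_comp]
    rw [← Category.assoc σ.r, eq_sub_of_add_eq σ.id]
    simp [reassoc_of% mor₂_comp_g]
  · rw [← reassoc_of% hj, e₂.hom_inv_id_assoc, σ.f_r]

end DistinguishedTriangle

namespace SplitSqZeroExtension

variable {k : Type v} {A I B : Type u} [Field k] [CommRing A] [Algebra k A]
  [AddCommGroup I] [Module A I] [CommRing B] [Algebra k B] (E : SplitSqZeroExtension k A I B)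

section Projective

variable {K : CochainComplex (ModuleCat.{u} B) ℤ}

lemma mono_mulC_of_projective (hK : ∀ n, Projective (K.X n)) : Mono (E.mulC K) :=
  HomologicalComplex.mono_of_mono_f _ fun n =>
    have := hK n
    (E.projective_shortExact (K.X n)).mono_f

lemma shortExact_of_mono_mulC [Mono (E.mulC K)] :
    (ShortComplex.mk (E.mulC K) (E.toBaseChangeC K) (E.mulC_toBaseChangeC K)).ShortExact where
  exact := E.mulC_toBaseChangeC_exact K

lemma admissible_of_mono_mulC [Mono (E.mulC K)] : E.Admissible K := by
  have isZero : IsZero (E.tor₁C.obj K) := IsZero.of_mono_eq_zero (E.torInclusionC K)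
    (zero_of_comp_mono (E.mulC K) (E.torInclusionC_mulC K))
  refine fun n => (HomologicalComplex.exactAt_iff ..).2 (ShortComplex.exact_of_isZero_X₂ _ ?_)
  exact (HomologicalComplex.eval _ _ n).map_isZero isZero

lemma admissible_of_projective (hK : ∀ n, Projective (K.X n)) : E.Admissible K :=
  have := E.mono_mulC_of_projective hK
  E.admissible_of_mono_mulC

end Projective

section FourTerm

variable {K L : CochainComplex (ModuleCat.{u} B) ℤ} (f : K ⟶ L)

variable (K) in
/-- The multiplication map `I ⊗ (K ⊗_B A) ⟶ I K`, where the submodule `I K` of `K` is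
represented by the kernel of `K ⟶ K ⊗_B A`. -/
noncomputable abbrev toIdealMul : E.idealTensorC.obj K ⟶ kernel (E.toBaseChangeC K) :=
  kernel.lift (E.toBaseChangeC K) (E.mulC K) (E.mulC_toBaseChangeC K)

instance epi_toIdealMul : Epi (E.toIdealMul K) :=
  (E.mulC_toBaseChangeC_exact K).epi_kernelLift

lemma torInclusionC_naturality :
    E.torInclusionC K ≫ E.idealTensorC.map f = E.tor₁C.map f ≫ E.torInclusionC L :=
  ((NatTrans.mapHomologicalComplex E.torInclusion (.up ℤ)).naturality f).symm

lemma mulC_naturality :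
    E.mulC K ≫ E.viaSectC.map f = E.idealTensorC.map f ≫ E.mulC L :=
  ((NatTrans.mapHomologicalComplex E.mul (.up ℤ)).naturality f).symm

lemma toBaseChangeC_naturality :
    E.toBaseChangeC K ≫ E.baseChangeC.map f = E.viaSectC.map f ≫ E.toBaseChangeC L :=
  ((NatTrans.mapHomologicalComplex E.toBaseChange (.up ℤ)).naturality f).symm

lemma quasiIso_viaSectC_map_iff : QuasiIso (E.viaSectC.map f) ↔ QuasiIso f :=
  HomologicalComplex.quasiIso_map_iff_of_preservesHomology f E.viaSect

lemma quasiIso_idealTensorC_map [Module.Flat A I] [QuasiIso (E.baseChangeC.map f)] :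
    QuasiIso (E.idealTensorC.map f) :=
  inferInstanceAs (QuasiIso (((MonoidalCategory.tensorLeft
    (ModuleCat.of A I)).mapHomologicalComplex (.up ℤ)).map (E.baseChangeC.map f)))

lemma quasiIso_tor₁C_map_iff [Module.Flat A I] [QuasiIso (E.baseChangeC.map f)] :
    QuasiIso (E.tor₁C.map f) ↔ QuasiIso f := by
  have := E.quasiIso_idealTensorC_map f
  rw [← E.quasiIso_viaSectC_map_iff f]
  exact YonedaTwo.quasiIso_first_iff_third (E.torInclusionC_naturality f) (E.mulC_naturality f)
    (E.toBaseChangeC_naturality f) (E.torInclusionC_mulC_exact K) (E.mulC_toBaseChangeC_exact K)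
    (E.torInclusionC_mulC_exact L) (E.mulC_toBaseChangeC_exact L)

lemma hkrClass_naturality [HasDerivedCategory.{w} (ModuleCat.{u} A)] :
    DerivedCategory.Q.map (E.baseChangeC.map f) ≫ E.hkrClass L =
      E.hkrClass K ≫ (DerivedCategory.Q.map (E.tor₁C.map f))⟦(2 : ℤ)⟧' :=
  YonedaTwo.extClass_naturality (E.torInclusionC_naturality f) (E.mulC_naturality f)
    (E.toBaseChangeC_naturality f) _ _ _ _

end FourTerm

section Vanishing

variable [HasDerivedCategory.{w} (ModuleCat.{u} A)]

lemma hkrClass_eq_zero_of_admissible {K : CochainComplex (ModuleCat.{u} B) ℤ}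
    (hK : E.Admissible K) : E.hkrClass K = 0 :=
  ((shiftFunctor _ (2 : ℤ)).map_isZero (YonedaTwo.isZero_Q_obj hK)).eq_of_tgt _ _

lemma hkrClass_eq_zero_of_section [HasDerivedCategory.{w'} (ModuleCat.{u} B)]
    (K : CochainComplex (ModuleCat.{u} B) ℤ) (hK : ProjectiveModels.boundedAbove _ K)
    (s : DerivedCategory.Q.obj (E.baseChangeC.obj K) ⟶
      E.derivedBaseChange.obj (ProjectiveModels.toMinus K hK))
    (hs : s ≫ E.derivedToBaseChange K hK = 𝟙 _) : E.hkrClass K = 0 := by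
  obtain ⟨b, hb⟩ := id hK
  obtain ⟨P, p, hp, hP, hPb⟩ := ProjectiveModels.exists_projective K b
  have hP' : ProjectiveModels.boundedAbove _ P := ⟨b, hPb⟩
  have := ProjectiveModels.isIso_fromLeftDerivedMinus E.baseChange hP' hP
  have naturality := ProjectiveModels.fromLeftDerivedMinus_naturality E.baseChange p hP' hK
  have map_hkrClass : DerivedCategory.Q.map (E.baseChangeC.map p) ≫ E.hkrClass K = 0 := by
    rw [E.hkrClass_naturality p,
      E.hkrClass_eq_zero_of_admissible (E.admissible_of_projective hP), zero_comp]
  have comp_hkrClass : E.derivedToBaseChange K hK ≫ E.hkrClass K = 0 := by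
    rw [← cancel_epi (E.derivedBaseChange.map (ProjectiveModels.toMinusMap p hP' hK)),
      reassoc_of% naturality, map_hkrClass, comp_zero, comp_zero]
  rw [← Category.id_comp (E.hkrClass K), ← hs, Category.assoc, comp_hkrClass, comp_zero]

end Vanishing

section Adm

variable {K L : CochainComplex (ModuleCat.{u} B) ℤ}

/-- The morphism of the admissible derived category given by a morphism of complexes. -/
noncomputable def toDerivedAdmMap (f : K ⟶ L) (hK : ProjectiveModels.boundedAbove _ K)
    (hL : ProjectiveModels.boundedAbove _ L) : E.toDerivedAdm K hK ⟶ E.toDerivedAdm L hL :=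
  E.admissibleW.Q.map (ObjectProperty.homMk ((HomotopyCategory.quotient _ _).map f))

lemma isIso_toDerivedAdmMap (f : K ⟶ L) (hK : ProjectiveModels.boundedAbove _ K)
    (hL : ProjectiveModels.boundedAbove _ L) [QuasiIso (E.baseChangeC.map f)]
    [QuasiIso (E.tor₁C.map f)] : IsIso (E.toDerivedAdmMap f hK hL) := by
  refine Localization.inverts E.admissibleW.Q E.admissibleW _ ?_
  refine ObjectProperty.trW.mk _ (HomotopyCategory.mappingCone_triangleh_distinguished f) ⟨?_, ?_⟩
  · exact (HomotopyCategory.quotient_obj_mem_subcategoryAcyclic_iff_acyclic _).2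
      ((MappingCone.acyclic_map_mappingCone_iff E.baseChange f).2 inferInstance)
  · exact (HomotopyCategory.quotient_obj_mem_subcategoryAcyclic_iff_acyclic _).2
      ((MappingCone.acyclic_map_mappingCone_iff E.tor₁ f).2 inferInstance)

variable [HasDerivedCategory.{w} (ModuleCat.{u} A)]

lemma baseChangeAdm_map_Q_map
    {X Y : (ProjectiveModels.homotopyMinus (ModuleCat.{u} B)).FullSubcategory} (f : X ⟶ Y) :
    E.baseChangeAdm.map (E.admissibleW.Q.map f) =
      DerivedCategory.Qh.map ((E.baseChange.mapHomotopyCategory (.up ℤ)).map f.hom) :=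
  (Functor.congr_hom (Localization.Construction.fac _ E.admissibleW_isInvertedBy) f).trans
    ((Category.id_comp _).trans (Category.comp_id _))

lemma baseChangeAdm_map_toDerivedAdmMap (f : K ⟶ L) (hK : ProjectiveModels.boundedAbove _ K)
    (hL : ProjectiveModels.boundedAbove _ L) :
    E.baseChangeAdm.map (E.toDerivedAdmMap f hK hL) =
      DerivedCategory.Q.map (E.baseChangeC.map f) :=
  E.baseChangeAdm_map_Q_map _

lemma isIso_baseChangeAdm_map_toDerivedAdmMap (f : K ⟶ L)
    (hK : ProjectiveModels.boundedAbove _ K) (hL : ProjectiveModels.boundedAbove _ L)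
    [QuasiIso (E.baseChangeC.map f)] :
    IsIso (E.baseChangeAdm.map (E.toDerivedAdmMap f hK hL)) := by
  rw [baseChangeAdm_map_toDerivedAdmMap]
  exact inferInstanceAs (IsIso (DerivedCategory.Q.map (E.baseChangeC.map f)))

lemma admissibleW_isInvertedBy_tor₁ :
    E.admissibleW.IsInvertedBy ((ProjectiveModels.homotopyMinus (ModuleCat.{u} B)).ι ⋙
      E.tor₁.mapHomotopyCategory (.up ℤ) ⋙ DerivedCategory.Qh) := fun _ _ _ hf =>
  ObjectProperty.inverseImage_trW_isInverted
    (P := HomotopyCategory.subcategoryAcyclic (ModuleCat.{u} A))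
    (F := E.tor₁.mapHomotopyCategory (.up ℤ)) DerivedCategory.Qh _
    (ObjectProperty.trW_monotone inf_le_right _ hf)

/-- The functor `K ↦ Tor₁^B(K, A)` from the admissible derived category of `B` to the derived
category of `A`. -/
noncomputable def torAdm : E.DerivedAdm ⥤ DerivedCategory (ModuleCat.{u} A) :=
  Localization.Construction.lift _ E.admissibleW_isInvertedBy_tor₁

lemma torAdm_map_Q_map
    {X Y : (ProjectiveModels.homotopyMinus (ModuleCat.{u} B)).FullSubcategory} (f : X ⟶ Y) :
    E.torAdm.map (E.admissibleW.Q.map f) =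
      DerivedCategory.Qh.map ((E.tor₁.mapHomotopyCategory (.up ℤ)).map f.hom) :=
  (Functor.congr_hom (Localization.Construction.fac _ E.admissibleW_isInvertedBy_tor₁) f).trans
    ((Category.id_comp _).trans (Category.comp_id _))

/-- The local HKR class as a natural transformation on the admissible derived category. -/
noncomputable def hkrAdm : E.baseChangeAdm ⟶ E.torAdm ⋙ shiftFunctor _ (2 : ℤ) :=
  Localization.Construction.natTransExtension
    { app X := E.hkrClass X.obj.as
      naturality X Y f := by
        obtain ⟨g, hg⟩ := (HomotopyCategory.quotient _ _).map_surjective f.hom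
        have h := E.hkrClass_naturality g
        have map_baseChange : DerivedCategory.Q.map (E.baseChangeC.map g) =
            E.baseChangeAdm.map (E.admissibleW.Q.map f) := by
          rw [baseChangeAdm_map_Q_map, ← hg]
          rfl
        have map_tor : DerivedCategory.Q.map (E.tor₁C.map g) =
            E.torAdm.map (E.admissibleW.Q.map f) := by
          rw [torAdm_map_Q_map, ← hg]
          rfl
        rwa [map_baseChange, map_tor] at h }

lemma hkrClass_eq_zero_of_adm (hK : ProjectiveModels.boundedAbove _ K)
    (hL : ProjectiveModels.boundedAbove _ L) (hK' : E.Admissible K)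
    (φ : E.toDerivedAdm K hK ⟶ E.toDerivedAdm L hL) [IsIso (E.baseChangeAdm.map φ)] :
    E.hkrClass L = 0 := by
  have app_K : E.hkrAdm.app (E.toDerivedAdm K hK) = 0 :=
    (Localization.Construction.NatTransExtension.app_eq _ _).trans
      (E.hkrClass_eq_zero_of_admissible hK')
  have app_L : E.hkrAdm.app (E.toDerivedAdm L hL) = E.hkrClass L :=
    Localization.Construction.NatTransExtension.app_eq _ _
  have naturality := E.hkrAdm.naturality φ
  rw [app_K, zero_comp] at naturality
  exact app_L.symm.trans ((cancel_epi (E.baseChangeAdm.map φ)).1 (naturality.trans comp_zero.symm))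

end Adm

variable (A I) in
/-- `M ↦ I ⊗ M`. -/
noncomputable abbrev tensorI :
    ModuleCat.{u} A ⥤ ModuleCat.{u} A :=
  MonoidalCategory.tensorLeft (ModuleCat.of A I)

variable (A I) in
/-- `M ↦ I ⊗ M`, termwise. -/
noncomputable abbrev tensorC :
    CochainComplex (ModuleCat.{u} A) ℤ ⥤ CochainComplex (ModuleCat.{u} A) ℤ :=
  (tensorI A I).mapHomologicalComplex (.up ℤ)

section Induction

/-- `M ↦ B ⊗_A M`, where `B` is an `A`-algebra via the splitting. -/
noncomputable abbrev induction : ModuleCat.{u} A ⥤ ModuleCat.{u} B :=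
  ModuleCat.extendScalars.{u, u, u} E.sect.toRingHom

/-- `M ↦ B ⊗_A M` is left adjoint to restriction along the splitting. -/
noncomputable abbrev inductionAdj : E.induction ⊣ E.viaSect :=
  ModuleCat.extendRestrictScalarsAdj.{u, u, u} E.sect.toRingHom

/-- `K ↦ K ⊗_B A` is left adjoint to restriction along the projection. -/
noncomputable abbrev baseChangeAdj : E.baseChange ⊣ E.viaProj :=
  ModuleCat.extendRestrictScalarsAdj.{u, u, u} E.proj.toRingHom

variable {M : ModuleCat.{u} A} {N : ModuleCat.{u} B}

variable (M) in
/-- The unit `M ⟶ B ⊗_A M`. -/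
noncomputable abbrev toInduction : M ⟶ E.viaSect.obj (E.induction.obj M) :=
  E.inductionAdj.unit.app M

/-- The `B`-linear extension to `B ⊗_A M` of an `A`-linear map out of `M`. -/
noncomputable def extend (g : M ⟶ E.viaSect.obj N) : E.induction.obj M ⟶ N :=
  (E.inductionAdj.homEquiv M N).symm g

lemma toInduction_extend (g : M ⟶ E.viaSect.obj N) :
    E.toInduction M ≫ E.viaSect.map (E.extend g) = g :=
  (E.inductionAdj.homEquiv_unit ..).symm.trans ((E.inductionAdj.homEquiv M N).apply_symm_apply g)

lemma induction_hom_ext {f g : E.induction.obj M ⟶ N}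
    (h : E.toInduction M ≫ E.viaSect.map f = E.toInduction M ≫ E.viaSect.map g) : f = g :=
  (E.inductionAdj.homEquiv M N).injective
    ((E.inductionAdj.homEquiv_unit ..).trans (h.trans (E.inductionAdj.homEquiv_unit ..).symm))

variable (M) in
/-- `M ⟶ (B ⊗_A M) ⊗_B A`. -/
noncomputable def toBaseChangeInduction : M ⟶ E.baseChange.obj (E.induction.obj M) :=
  E.toInduction M ≫ E.toBaseChange.app (E.induction.obj M)

lemma toBaseChangeInduction_extend (g : M ⟶ E.viaSect.obj N) :
    E.toBaseChangeInduction M ≫ E.baseChange.map (E.extend g) = g ≫ E.toBaseChange.app N := by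
  have naturality := E.toBaseChange.naturality (E.extend g)
  rw [toBaseChangeInduction, Category.assoc, ← naturality, reassoc_of% E.toInduction_extend]

/-- Restricting an `A`-module to `B` and back to `A` changes nothing. -/
noncomputable def viaSectViaProjIso (L : ModuleCat.{u} A) :
    L ≅ E.viaSect.obj (E.viaProj.obj L) :=
  (ModuleCat.restrictScalarsId'App _ (RingHom.ext E.proj_sect) L).symm ≪≫
    ModuleCat.restrictScalarsComp'App E.sect.toRingHom E.proj.toRingHom _ rfl L

lemma viaSect_map_homEquiv {L : ModuleCat.{u} A} (φ : E.baseChange.obj N ⟶ L) :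
    E.viaSect.map (E.baseChangeAdj.homEquiv N L φ) =
      E.toBaseChange.app N ≫ φ ≫ (E.viaSectViaProjIso L).hom := by
  rw [E.baseChangeAdj.homEquiv_unit]
  ext x
  rfl

instance isIso_toBaseChangeInduction : IsIso (E.toBaseChangeInduction M) := by
  refine isIso_of_coyoneda_map_bijective _ fun L => ?_
  have factor : (fun φ : E.baseChange.obj (E.induction.obj M) ⟶ L =>
      (E.toBaseChangeInduction M ≫ φ) ≫ (E.viaSectViaProjIso L).hom) =
      E.inductionAdj.homEquiv _ _ ∘ E.baseChangeAdj.homEquiv _ _ := by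
    funext φ
    rw [Function.comp_apply, E.inductionAdj.homEquiv_unit, viaSect_map_homEquiv,
      toBaseChangeInduction, Category.assoc, Category.assoc]
  refine ((E.viaSectViaProjIso L).homToEquiv.comp_bijective _).1 (?_ : Function.Bijective
    fun φ => (E.toBaseChangeInduction M ≫ φ) ≫ (E.viaSectViaProjIso L).hom)
  rw [factor]
  exact (E.inductionAdj.homEquiv _ _).bijective.comp (E.baseChangeAdj.homEquiv _ _).bijective

variable (M) in
/-- The inclusion `I ⊗ M ⟶ B ⊗_A M`. -/
noncomputable def tensorToInduction :
    (tensorI A I).obj M ⟶ E.viaSect.obj (E.induction.obj M) :=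
  (tensorI A I).map (E.toBaseChangeInduction M) ≫ E.mul.app (E.induction.obj M)

lemma tensorToInduction_toBaseChange :
    E.tensorToInduction M ≫ E.toBaseChange.app (E.induction.obj M) = 0 := by
  have mul_toBaseChange := congr_app E.mul_comp_toBaseChange (E.induction.obj M)
  rw [tensorToInduction, Category.assoc]
  exact (congr_arg _ mul_toBaseChange).trans comp_zero

lemma tensorToInduction_extend (g : M ⟶ E.viaSect.obj N) :
    E.tensorToInduction M ≫ E.viaSect.map (E.extend g) =
      (tensorI A I).map (g ≫ E.toBaseChange.app N) ≫ E.mul.app N := by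
  have naturality := E.mul.naturality (E.extend g)
  rw [tensorToInduction, Category.assoc, ← naturality, ← toBaseChangeInduction_extend,
    Functor.map_comp, Category.assoc]
  rfl

end Induction

section Twist

open CochainComplex HomComplex

variable {Y : CochainComplex (ModuleCat.{u} A) ℤ} (c : Cocycle Y ((tensorC A I).obj Y) 1)
  {i j : ℤ} (h : i + 1 = j)

/-- The components `Y.X i ⟶ I ⊗ Y.X j` of a cocycle `Y ⟶ I ⊗ Y` of degree one. -/
noncomputable def component : Y.X i ⟶ (tensorI A I).obj (Y.X j) :=
  c.1.v i j h

lemma component_comp_d_add {l : ℤ} (h' : j + 1 = l) :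
    component c h ≫ (tensorI A I).map (Y.d j l) + Y.d i j ≫ component c h' = 0 :=
  ConnectingCocycle.v_comp_d_add c h h'

/-- The differential of `twist`, restricted to `Y ⊆ B ⊗_A Y`. -/
noncomputable def twistD : Y.X i ⟶ E.viaSect.obj (E.induction.obj (Y.X j)) :=
  Y.d i j ≫ E.toInduction (Y.X j) + component c h ≫ E.tensorToInduction (Y.X j)

lemma twistD_toBaseChange :
    E.twistD c h ≫ E.toBaseChange.app _ = Y.d i j ≫ E.toBaseChangeInduction (Y.X j) := by
  rw [twistD, Preadditive.add_comp, Category.assoc, Category.assoc,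
    tensorToInduction_toBaseChange, comp_zero, add_zero, toBaseChangeInduction]

lemma twistD_extend {N : ModuleCat.{u} B} (g : Y.X j ⟶ E.viaSect.obj N) :
    E.twistD c h ≫ E.viaSect.map (E.extend g) = Y.d i j ≫ g +
      component c h ≫ (tensorI A I).map (g ≫ E.toBaseChange.app N) ≫ E.mul.app N := by
  rw [twistD, Preadditive.add_comp, Category.assoc, Category.assoc, toInduction_extend,
    tensorToInduction_extend]

lemma twistD_extend_twistD {l : ℤ} (h' : j + 1 = l) :
    E.twistD c h ≫ E.viaSect.map (E.extend (E.twistD c h')) = 0 := by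
  rw [twistD_extend, twistD_toBaseChange, twistD, Preadditive.comp_add, Y.d_comp_d_assoc,
    zero_comp, zero_add, Functor.map_comp, Category.assoc, ← tensorToInduction, ← Category.assoc,
    ← Category.assoc (component c h), ← Preadditive.add_comp, add_comm, component_comp_d_add,
    zero_comp]

/-- The complex `B ⊗_A Y` with its differential twisted by a cocycle `Y ⟶ I ⊗ Y` of degree one. -/
noncomputable def twist : CochainComplex (ModuleCat.{u} B) ℤ where
  X n := E.induction.obj (Y.X n)
  d i j := if h : i + 1 = j then E.extend (E.twistD c h) else 0
  shape i j h := dif_neg h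
  d_comp_d' i j l (hij : i + 1 = j) (hjl : j + 1 = l) := by
    rw [dif_pos hij, dif_pos hjl]
    apply E.induction_hom_ext
    rw [Functor.map_comp, reassoc_of% E.toInduction_extend, twistD_extend_twistD,
      Functor.map_zero, comp_zero]

lemma twist_d : (E.twist c).d i j = E.extend (E.twistD c h) :=
  dif_pos h

/-- `Y` is the base change of every twist of `B ⊗_A Y`. -/
noncomputable def twistIso : Y ≅ E.baseChangeC.obj (E.twist c) :=
  HomologicalComplex.Hom.isoOfComponents (fun n =>
    show Y.X n ≅ E.baseChange.obj (E.induction.obj (Y.X n)) from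
      asIso (E.toBaseChangeInduction (Y.X n)))
    (fun i j (h : i + 1 = j) => by
      refine Eq.trans ?_ ((E.toBaseChangeInduction_extend (E.twistD c h)).trans
        (E.twistD_toBaseChange c h))
      exact congr_arg (fun d : E.induction.obj (Y.X i) ⟶ E.induction.obj (Y.X j) =>
        E.toBaseChangeInduction (Y.X i) ≫ E.baseChange.map d) (E.twist_d c h))

lemma projective_twist (hY : ∀ n, Projective (Y.X n)) (n : ℤ) :
    Projective ((E.twist c).X n) :=
  E.inductionAdj.map_projective _ (hY n)

instance isStrictlyLE_twist (b : ℤ) [Y.IsStrictlyLE b] : (E.twist c).IsStrictlyLE b := by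
  rw [CochainComplex.isStrictlyLE_iff]
  exact fun i hi => E.induction.map_isZero (Y.isZero_of_isStrictlyLE b i hi)

section

variable {K : CochainComplex (ModuleCat.{u} B) ℤ}

/-- The components `Y.X n ⟶ K.X n` of a cochain of degree zero. -/
noncomputable def component₀ (u : Cochain Y (E.viaSectC.obj K) 0) (n : ℤ) :
    Y.X n ⟶ E.viaSect.obj (K.X n) :=
  u.v n n (add_zero n)

variable {u : Cochain Y (E.viaSectC.obj K) 0} {ρ : Y ⟶ E.baseChangeC.obj K}

lemma comp_toBaseChangeC_eq_iff :
    u.comp (Cochain.ofHom (E.toBaseChangeC K)) (add_zero 0) = Cochain.ofHom ρ ↔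
      ∀ n, E.component₀ u n ≫ E.toBaseChange.app (K.X n) = ρ.f n := by
  have value (n : ℤ) : (u.comp (Cochain.ofHom (E.toBaseChangeC K)) (add_zero 0)).v n n
      (add_zero n) = E.component₀ u n ≫ E.toBaseChange.app (K.X n) := by
    rw [Cochain.comp_zero_cochain_v, Cochain.ofHom_v]
    rfl
  refine ⟨fun hu n => ?_, fun hu => Cochain.ext₀ _ _ fun n => ?_⟩
  · rw [← value, hu, Cochain.ofHom_v]
  · rw [value, hu, Cochain.ofHom_v]

lemma δ_eq_comp_mulC_iff :
    δ 0 1 u = c.1.comp (Cochain.ofHom ((tensorC A I).map ρ ≫ E.mulC K)) (add_zero 1) ↔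
      ∀ i j (h : i + 1 = j), E.component₀ u i ≫ E.viaSect.map (K.d i j) =
        Y.d i j ≫ E.component₀ u j +
          component c h ≫ (tensorI A I).map (ρ.f j) ≫ E.mul.app (K.X j) := by
  have coboundary (i j : ℤ) (h : i + 1 = j) : (δ 0 1 u).v i j h =
      E.component₀ u i ≫ E.viaSect.map (K.d i j) - Y.d i j ≫ E.component₀ u j :=
    δ_zero_cochain_v ..
  have value (i j : ℤ) (h : i + 1 = j) :
      (c.1.comp (Cochain.ofHom ((tensorC A I).map ρ ≫ E.mulC K)) (add_zero 1)).v i j h =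
        component c h ≫ (tensorI A I).map (ρ.f j) ≫ E.mul.app (K.X j) := by
    rw [Cochain.comp_zero_cochain_v, Cochain.ofHom_v]
    rfl
  refine ⟨fun hu i j h => sub_eq_iff_eq_add'.1 ?_, fun hu => Cochain.ext _ _ fun i j h => ?_⟩
  · exact (coboundary i j h).symm.trans (congr($hu |>.v i j h).trans (value i j h))
  · exact (coboundary i j h).trans ((sub_eq_iff_eq_add'.2 (hu i j h)).trans (value i j h).symm)

end

/-- The degree zero cochain `Y ⟶ B ⊗_A Y` into a twist. -/
noncomputable def toTwist : Cochain Y (E.viaSectC.obj (E.twist c)) 0 :=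
  Cochain.ofHoms (G := E.viaSectC.obj (E.twist c)) fun n => E.toInduction (Y.X n)

lemma component₀_toTwist (n : ℤ) : E.component₀ (E.toTwist c) n = E.toInduction (Y.X n) :=
  Cochain.ofHoms_v ..

lemma toTwist_toBaseChangeC :
    (E.toTwist c).comp (Cochain.ofHom (E.toBaseChangeC (E.twist c))) (add_zero 0) =
      Cochain.ofHom (E.twistIso c).hom := by
  refine E.comp_toBaseChangeC_eq_iff.2 fun n => ?_
  rw [component₀_toTwist]
  rfl

lemma δ_toTwist :
    δ 0 1 (E.toTwist c) = c.1.comp (Cochain.ofHom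
      ((tensorC A I).map (E.twistIso c).hom ≫ E.mulC (E.twist c))) (add_zero 1) := by
  refine (E.δ_eq_comp_mulC_iff c).2 fun i j h => ?_
  rw [component₀_toTwist, component₀_toTwist, E.twist_d c h]
  exact E.toInduction_extend _

variable {c} {K : CochainComplex (ModuleCat.{u} B) ℤ} {ρ : Y ⟶ E.baseChangeC.obj K}
  {u : Cochain Y (E.viaSectC.obj K) 0}
  (hu : u.comp (Cochain.ofHom (E.toBaseChangeC K)) (add_zero 0) = Cochain.ofHom ρ)
  (hu' : δ 0 1 u = c.1.comp (Cochain.ofHom ((tensorC A I).map ρ ≫ E.mulC K)) (add_zero 1))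

/-- The morphism out of a twist of `B ⊗_A Y` which restricts to a given cochain on `Y`. -/
noncomputable def twistDesc : E.twist c ⟶ K where
  f n := E.extend (E.component₀ u n)
  comm' i j (h : i + 1 = j) := by
    have extension : E.toInduction (Y.X i) ≫
        E.viaSect.map (E.extend (E.component₀ u i) ≫ K.d i j) = E.toInduction (Y.X i) ≫
          E.viaSect.map (E.extend (E.twistD c h) ≫ E.extend (E.component₀ u j)) := by
      rw [Functor.map_comp, Functor.map_comp, reassoc_of% E.toInduction_extend,
        reassoc_of% E.toInduction_extend, twistD_extend, E.comp_toBaseChangeC_eq_iff.1 hu,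
        (E.δ_eq_comp_mulC_iff c).1 hu' i j h]
      rfl
    rw [E.twist_d c h]
    exact E.induction_hom_ext extension

lemma twistIso_hom_map_twistDesc :
    (E.twistIso c).hom ≫ E.baseChangeC.map (E.twistDesc hu hu') = ρ := by
  ext n : 1
  exact (E.toBaseChangeInduction_extend _).trans (E.comp_toBaseChangeC_eq_iff.1 hu n)

end Twist

section Lifting

open CochainComplex HomComplex

variable {K : CochainComplex (ModuleCat.{u} B) ℤ} [HasDerivedCategory.{w} (ModuleCat.{u} A)]

lemma exists_cocycle_of_hkrClass_eq_zero [Module.Flat A I] (hK : E.hkrClass K = 0)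
    {R : CochainComplex (ModuleCat.{u} A) ℤ} [∀ n, Projective (R.X n)] [R.IsKProjective]
    (ρ : R ⟶ E.baseChangeC.obj K) [QuasiIso ρ] :
    ∃ (c : Cocycle R ((tensorC A I).obj R) 1) (u : Cochain R (E.viaSectC.obj K) 0),
      u.comp (Cochain.ofHom (E.toBaseChangeC K)) (add_zero 0) = Cochain.ofHom ρ ∧
      δ 0 1 u = c.1.comp (Cochain.ofHom ((tensorC A I).map ρ ≫ E.mulC K)) (add_zero 1) := by
  obtain ⟨a, ha⟩ := YonedaTwo.exists_factor_of_extClass_eq_zero hK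
  let ρI : (tensorC A I).obj R ⟶ E.idealTensorC.obj K := (tensorC A I).map ρ
  have : QuasiIso ρI := inferInstanceAs (QuasiIso ((tensorC A I).map ρ))
  obtain ⟨α, hα⟩ := ProjectiveModels.exists_map_eq (DerivedCategory.Q.map ρ ≫ a ≫
    (inv (DerivedCategory.Q.map ρI))⟦(1 : ℤ)⟧' ≫
    (DerivedCategory.Q.commShiftIso (1 : ℤ)).inv.app _)
  let c := Cocycle.equivHomShift α
  have Q_map_c : DerivedCategory.Q.map ρ ≫
      DerivedCategory.triangleOfSESδ (YonedaTwo.right_shortExact (E.toBaseChangeC K)) =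
        DerivedCategory.Q.map (Cocycle.equivHomShift.symm (c.postcomp (ρI ≫ E.toIdealMul K))) ≫
          (DerivedCategory.Q.commShiftIso (1 : ℤ)).hom.app _ := by
    have naturality := DerivedCategory.Q.commShiftIso_hom_naturality (ρI ≫ E.toIdealMul K) (1 : ℤ)
    rw [Cocycle.equivHomShift_symm_postcomp, AddEquiv.symm_apply_apply, Functor.map_comp, hα, ha]
    simp only [Category.assoc]
    rw [naturality, Iso.inv_hom_id_app_assoc, ← Functor.map_comp, Functor.map_comp _ ρI,
      IsIso.inv_hom_id_assoc]
  obtain ⟨u, hu, hu'⟩ := ConnectingCocycle.exists_cochain_of_Q_map_triangleOfSESδ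
    (YonedaTwo.right_shortExact (E.toBaseChangeC K)) ρ (c.postcomp (ρI ≫ E.toIdealMul K)) Q_map_c
  refine ⟨c, u, hu, hu'.trans ?_⟩
  have toIdealMul_ι : (ρI ≫ E.toIdealMul K) ≫ kernel.ι (E.toBaseChangeC K) =
      (tensorC A I).map ρ ≫ E.mulC K := by
    rw [Category.assoc, kernel.lift_ι]
    rfl
  rw [← toIdealMul_ι, Cochain.ofHom_comp, ← Cochain.comp_assoc_of_third_is_zero_cochain]
  rfl

lemma exists_projective_of_hkrClass_eq_zero [Module.Flat A I] (hK : E.hkrClass K = 0) (b : ℤ)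
    [K.IsStrictlyLE b] :
    ∃ (S : CochainComplex (ModuleCat.{u} B) ℤ) (f : S ⟶ K),
      (∀ n, Projective (S.X n)) ∧ S.IsStrictlyLE b ∧ QuasiIso (E.baseChangeC.map f) ∧
      Epi (E.baseChangeC.map f) := by
  have := ProjectiveModels.isStrictlyLE_map E.baseChange K b
  obtain ⟨R, ρ, hρ, hR, hRb, hρ'⟩ := ProjectiveModels.exists_projective_epi (E.baseChangeC.obj K) b
  have : R.IsKProjective := ProjectiveModels.isKProjective_of_boundedAbove ⟨b, hRb⟩ hR
  obtain ⟨c, u, hu, hu'⟩ := E.exists_cocycle_of_hkrClass_eq_zero hK ρ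
  have factor := E.twistIso_hom_map_twistDesc hu hu'
  refine ⟨E.twist c, E.twistDesc hu hu', E.projective_twist c hR, inferInstance, ?_,
    epi_of_epi_fac factor⟩
  rwa [← quasiIso_iff_comp_left (E.twistIso c).hom, factor]

end Lifting

section Truncation

open CochainComplex

lemma isGE_of_isGE_baseChangeC [Module.Flat A I] {S : CochainComplex (ModuleCat.{u} B) ℤ}
    (hS : ∀ n, Projective (S.X n)) (c : ℤ) [IsGE (E.baseChangeC.obj S) c] : S.IsGE c := by
  rw [isGE_iff]
  intro n hn
  have baseChange_exact : (E.baseChangeC.obj S).ExactAt n :=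
    (isGE_iff (E.baseChangeC.obj S) c).1 inferInstance n hn
  have idealTensor_exact : (E.idealTensorC.obj S).ExactAt n := baseChange_exact.map (tensorI A I)
  have := E.mono_mulC_of_projective hS
  have viaSect_exact : (E.viaSectC.obj S).ExactAt n :=
    E.shortExact_of_mono_mulC.exactAt_X₂ n idealTensor_exact baseChange_exact
  exact (ShortComplex.exact_map_iff_of_faithful (S.sc n) E.viaSect).1 viaSect_exact

lemma exists_truncation [Module.Flat A I] {S K : CochainComplex (ModuleCat.{u} B) ℤ} (f : S ⟶ K)
    (c : ℤ) [K.IsStrictlyGE c] (hS : ∀ n, Projective (S.X n)) [QuasiIso (E.baseChangeC.map f)] :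
    ∃ g : S.truncGE c ⟶ K, S.πTruncGE c ≫ g = f ∧ E.Admissible (S.truncGE c) ∧
      QuasiIso (E.baseChangeC.map g) := by
  have := Truncation.isStrictlyGE_map E.baseChange K c
  have : IsGE (E.baseChangeC.obj S) c := (isGE_iff _ c).2 fun n hn =>
    (exactAt_iff_of_quasiIsoAt (E.baseChangeC.map f) n).2
      ((isGE_iff (E.baseChangeC.obj K) c).1 inferInstance n hn)
  have := E.isGE_of_isGE_baseChangeC hS c
  have quasiIso_π : QuasiIso (S.πTruncGE c) := (S.quasiIso_πTruncGE_iff c).2 inferInstance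
  have := Truncation.quasiIso_map_πTruncGE E.baseChangeAdj S c
  have quasiIso_tor := (E.quasiIso_tor₁C_map_iff (S.πTruncGE c)).2 quasiIso_π
  obtain ⟨g, hg⟩ := Truncation.exists_πTruncGE_comp_eq f c
  have factor : E.baseChangeC.map (S.πTruncGE c) ≫ E.baseChangeC.map g = E.baseChangeC.map f := by
    rw [← Functor.map_comp, hg]
  refine ⟨g, hg, fun n => ?_, ?_⟩
  · exact (exactAt_iff_of_quasiIsoAt (E.tor₁C.map (S.πTruncGE c)) n).1
      (E.admissible_of_projective hS n)
  · rw [← quasiIso_iff_comp_left (E.baseChangeC.map (S.πTruncGE c)), factor]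
    infer_instance

end Truncation

section Quotient

open ProjectiveModels

variable (V : CochainComplex (ModuleCat.{u} B) ℤ) {T : CochainComplex (ModuleCat.{u} A) ℤ}
  (t : T ⟶ E.idealTensorC.obj V)

lemma baseChangeC_map_mulBC : E.baseChangeC.map (E.mulBC V) = 0 := by
  have baseChange_map_mulB (M : ModuleCat.{u} B) : E.baseChange.map (E.mulB.app M) = 0 := by
    have : Epi (E.toBaseChange.app (E.viaProj.obj (E.idealTensor.obj M))) :=
      (ModuleCat.epi_iff_surjective _).2 (E.toBaseChange_surjective _)
    rw [← cancel_epi (E.toBaseChange.app (E.viaProj.obj (E.idealTensor.obj M))), comp_zero]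
    refine (E.toBaseChange.naturality (E.mulB.app M)).symm.trans ?_
    ext x
    exact congr($(congr_app E.mul_comp_toBaseChange M) x)
  ext1 n
  exact baseChange_map_mulB (V.X n)

instance isIso_baseChangeC_map_quotientComplexπ :
    IsIso (E.baseChangeC.map (E.quotientComplexπ V t)) := by
  have exact := (ShortComplex.exact_cokernel
    (E.viaProjC.map t ≫ E.mulBC V)).map_of_epi_of_preservesCokernel E.baseChangeC
      (inferInstanceAs (Epi (E.quotientComplexπ V t))) inferInstance
  have : Mono (E.baseChangeC.map (E.quotientComplexπ V t)) := exact.mono_g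
    ((E.baseChangeC.map_comp ..).trans (by rw [baseChangeC_map_mulBC]; exact comp_zero))
  exact isIso_of_mono_of_epi _

variable {V} {K : CochainComplex (ModuleCat.{u} B) ℤ} (g : V ⟶ K)

/-- For `g : V ⟶ K`, the subcomplex of `I ⊗ (V ⊗_B A)` of the elements whose product in `V` is
killed by `g`. -/
noncomputable abbrev mulKernel : CochainComplex (ModuleCat.{u} A) ℤ :=
  kernel (E.mulC V ≫ E.viaSectC.map g)

/-- The inclusion of `mulKernel`. -/
noncomputable abbrev mulKernelι : E.mulKernel g ⟶ E.idealTensorC.obj V :=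
  kernel.ι (E.mulC V ≫ E.viaSectC.map g)

lemma mulKernelι_mulBC_comp : (E.viaProjC.map (E.mulKernelι g) ≫ E.mulBC V) ≫ g = 0 := by
  ext n x
  exact congr(($(kernel.condition (E.mulC V ≫ E.viaSectC.map g))).f n x)

/-- The morphism `V / T ⟶ K` induced by `g : V ⟶ K`, where `T` is `mulKernel g`. -/
noncomputable def quotientDesc : E.quotientComplex V (E.mulKernelι g) ⟶ K :=
  cokernel.desc _ g (E.mulKernelι_mulBC_comp g)

lemma quotientComplexπ_quotientDesc :
    E.quotientComplexπ V (E.mulKernelι g) ≫ E.quotientDesc g = g :=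
  cokernel.π_desc ..

lemma baseChangeC_map_quotientDesc :
    E.baseChangeC.map (E.quotientComplexπ V (E.mulKernelι g)) ≫
      E.baseChangeC.map (E.quotientDesc g) = E.baseChangeC.map g := by
  rw [← Functor.map_comp, quotientComplexπ_quotientDesc]

instance quasiIso_baseChangeC_map_quotientDesc [QuasiIso (E.baseChangeC.map g)] :
    QuasiIso (E.baseChangeC.map (E.quotientDesc g)) := by
  rw [← quasiIso_iff_comp_left (E.baseChangeC.map (E.quotientComplexπ V (E.mulKernelι g))),
    baseChangeC_map_quotientDesc]
  infer_instance

/-- The morphism `I V ⟶ I K` induced by `g : V ⟶ K`. -/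
noncomputable abbrev idealMulMap : kernel (E.toBaseChangeC V) ⟶ kernel (E.toBaseChangeC K) :=
  kernel.map _ _ (E.viaSectC.map g) (E.baseChangeC.map g) (E.toBaseChangeC_naturality g)

lemma idealTensorC_map_toIdealMul_ι :
    (E.idealTensorC.map g ≫ E.toIdealMul K) ≫ kernel.ι (E.toBaseChangeC K) =
      E.mulC V ≫ E.viaSectC.map g := by
  rw [Category.assoc, kernel.lift_ι, mulC_naturality]

lemma toIdealMul_naturality :
    E.toIdealMul V ≫ E.idealMulMap g = E.idealTensorC.map g ≫ E.toIdealMul K := by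
  rw [← cancel_mono (kernel.ι (E.toBaseChangeC K)), idealTensorC_map_toIdealMul_ι, Category.assoc,
    kernel.lift_ι, kernel.lift_ι_assoc]

lemma mulKernelι_toIdealMul : E.mulKernelι g ≫ E.idealTensorC.map g ≫ E.toIdealMul K = 0 := by
  rw [← cancel_mono (kernel.ι (E.toBaseChangeC K)), Category.assoc, idealTensorC_map_toIdealMul_ι,
    kernel.condition, zero_comp]

lemma mulKernel_shortExact [Epi (E.baseChangeC.map g)] :
    (ShortComplex.mk _ _ (E.mulKernelι_toIdealMul g)).ShortExact where
  exact := (ShortComplex.exact_iff_of_epi_of_isIso_of_mono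
    (S₁ := .mk _ _ (E.mulKernelι_toIdealMul g))
    (S₂ := .mk _ _ (kernel.condition (E.mulC V ≫ E.viaSectC.map g)))
    { τ₁ := 𝟙 _, τ₂ := 𝟙 _, τ₃ := kernel.ι (E.toBaseChangeC K)
      comm₂₃ := (Category.id_comp _).trans (E.idealTensorC_map_toIdealMul_ι g).symm }).2
        (ShortComplex.exact_kernel (E.mulC V ≫ E.viaSectC.map g))
  epi_g :=
    have : Epi (E.idealTensorC.map g) :=
      inferInstanceAs (Epi ((tensorC A I).map (E.baseChangeC.map g)))
    epi_comp _ _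

lemma exists_quasiIso_mulKernel_tor₁C [Module.Flat A I] [QuasiIso (E.baseChangeC.map g)]
    [Epi (E.baseChangeC.map g)] : ∃ τ : E.mulKernel g ⟶ E.tor₁C.obj K, QuasiIso τ := by
  have torSequence := YonedaTwo.left_shortExact (E.torInclusionC K) (E.mulC K) (E.toBaseChangeC K)
    _ _ (E.torInclusionC_mulC_exact K) (E.mulC_toBaseChangeC_exact K)
  let τ : E.mulKernel g ⟶ E.tor₁C.obj K := torSequence.exact.lift
    (E.mulKernelι g ≫ E.idealTensorC.map g)
    ((Category.assoc ..).trans (E.mulKernelι_toIdealMul g))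
  let φ : ShortComplex.mk _ _ (E.mulKernelι_toIdealMul g) ⟶ YonedaTwo.leftSequence
      (E.torInclusionC_mulC K) (E.mulC_toBaseChangeC K) :=
    { τ₁ := τ
      τ₂ := E.idealTensorC.map g
      τ₃ := 𝟙 _
      comm₁₂ := torSequence.exact.lift_f ..
      comm₂₃ := (Category.comp_id _).symm }
  have : QuasiIso φ.τ₂ := E.quasiIso_idealTensorC_map g
  have : QuasiIso φ.τ₃ := inferInstanceAs (QuasiIso (𝟙 _))
  exact ⟨τ, YonedaTwo.quasiIso_τ₁ φ (E.mulKernel_shortExact g) torSequence⟩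

lemma isIso_idealMulMap_quotientDesc [Epi (E.baseChangeC.map g)] :
    IsIso (E.idealMulMap (E.quotientDesc g)) := by
  let π := E.quotientComplexπ V (E.mulKernelι g)
  have : IsIso (E.idealTensorC.map π) :=
    inferInstanceAs (IsIso ((tensorC A I).map (E.baseChangeC.map _)))
  have mulKernel_shortExact := E.mulKernel_shortExact g
  have : Epi (E.idealTensorC.map g ≫ E.toIdealMul K) := mulKernel_shortExact.epi_g
  have comp_idealMulMap : (E.idealTensorC.map π ≫ E.toIdealMul _) ≫
      E.idealMulMap (E.quotientDesc g) = E.idealTensorC.map g ≫ E.toIdealMul K := by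
    rw [Category.assoc, toIdealMul_naturality, ← Functor.map_comp_assoc,
      quotientComplexπ_quotientDesc]
  have mulKernelι_comp : E.mulKernelι g ≫ E.idealTensorC.map π ≫ E.toIdealMul _ = 0 := by
    rw [← cancel_mono (kernel.ι _), Category.assoc, idealTensorC_map_toIdealMul_ι, zero_comp]
    ext n x
    exact congr(($(cokernel.condition (E.viaProjC.map (E.mulKernelι g) ≫ E.mulBC V))).f n x)
  let s : kernel (E.toBaseChangeC K) ⟶ kernel _ := mulKernel_shortExact.exact.desc _ mulKernelι_comp
  have comp_s : (E.idealTensorC.map g ≫ E.toIdealMul K) ≫ s =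
      E.idealTensorC.map π ≫ E.toIdealMul _ := mulKernel_shortExact.exact.g_desc _ mulKernelι_comp
  refine ⟨s, ?_, ?_⟩
  · rw [← cancel_epi (E.idealTensorC.map π ≫ E.toIdealMul _), ← Category.assoc, comp_idealMulMap,
      comp_s, Category.comp_id]
  · rw [← cancel_epi (E.idealTensorC.map g ≫ E.toIdealMul K), ← Category.assoc, comp_s,
      comp_idealMulMap, Category.comp_id]

lemma quasiIso_quotientDesc [QuasiIso (E.baseChangeC.map g)] [Epi (E.baseChangeC.map g)] :
    QuasiIso (E.quotientDesc g) := by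
  let φ : YonedaTwo.rightSequence (E.toBaseChangeC (E.quotientComplex V (E.mulKernelι g))) ⟶
      YonedaTwo.rightSequence (E.toBaseChangeC K) :=
    YonedaTwo.rightMap (E.toBaseChangeC_naturality (E.quotientDesc g))
  have : IsIso φ.τ₁ := E.isIso_idealMulMap_quotientDesc g
  have : QuasiIso φ.τ₃ := E.quasiIso_baseChangeC_map_quotientDesc g
  rw [← E.quasiIso_viaSectC_map_iff]
  exact YonedaTwo.quasiIso_τ₂ φ (YonedaTwo.right_shortExact _) (YonedaTwo.right_shortExact _)

lemma nonempty_toDerivedAdm_iso_quotientComplex [Module.Flat A I] [QuasiIso (E.baseChangeC.map g)]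
    [Epi (E.baseChangeC.map g)] (hV : boundedAbove _ V) (hK : boundedAbove _ K) :
    Nonempty (E.toDerivedAdm K hK ≅ E.toDerivedAdm (E.quotientComplex V (E.mulKernelι g))
      (E.quotientComplex_boundedAbove V _ hV)) := by
  have : QuasiIso (E.tor₁C.map (E.quotientDesc g)) :=
    (E.quasiIso_tor₁C_map_iff (E.quotientDesc g)).2 (E.quasiIso_quotientDesc g)
  have := E.isIso_toDerivedAdmMap (E.quotientDesc g) (E.quotientComplex_boundedAbove V _ hV) hK
  exact ⟨(asIso (E.toDerivedAdmMap (E.quotientDesc g) _ hK)).symm⟩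

lemma exists_adm_of_iso_quotientComplex [HasDerivedCategory.{w} (ModuleCat.{u} A)]
    {t : T ⟶ E.idealTensorC.obj V} (hV : boundedAbove _ V) (hK : boundedAbove _ K)
    (e : E.toDerivedAdm K hK ≅
      E.toDerivedAdm (E.quotientComplex V t) (E.quotientComplex_boundedAbove V t hV)) :
    ∃ φ : E.toDerivedAdm V hV ⟶ E.toDerivedAdm K hK, IsIso (E.baseChangeAdm.map φ) := by
  have := E.isIso_baseChangeAdm_map_toDerivedAdmMap (E.quotientComplexπ V t) hV
    (E.quotientComplex_boundedAbove V t hV)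
  refine ⟨E.toDerivedAdmMap (E.quotientComplexπ V t) hV _ ≫ e.inv, ?_⟩
  rw [Functor.map_comp]
  infer_instance

end Quotient

section Existence

open ProjectiveModels

variable [HasDerivedCategory.{w} (ModuleCat.{u} A)]
  {V K : CochainComplex (ModuleCat.{u} B) ℤ}

lemma exists_admissible_of_hkrClass_eq_zero [Module.Flat A I] {b : ℤ}
    (hK : boundedLE (ModuleCat.{u} B) b K) (h : E.hkrClass K = 0) :
    ∃ (V : CochainComplex (ModuleCat.{u} B) ℤ) (g : V ⟶ K), boundedLE (ModuleCat.{u} B) b V ∧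
      E.Admissible V ∧ QuasiIso (E.baseChangeC.map g) ∧ Epi (E.baseChangeC.map g) := by
  obtain ⟨_, c, _⟩ := hK
  obtain ⟨S, f, hS, _, _, epi_f⟩ := E.exists_projective_of_hkrClass_eq_zero h b
  obtain ⟨g, hg, admissible, quasiIso_g⟩ := E.exists_truncation f c hS
  have : Epi (E.baseChangeC.map (S.πTruncGE c) ≫ E.baseChangeC.map g) := by
    rwa [← Functor.map_comp, hg]
  exact ⟨S.truncGE c, g, ⟨Truncation.isStrictlyLE_of_epi (S.πTruncGE c) b, c, inferInstance⟩,
    admissible, quasiIso_g, epi_of_epi (E.baseChangeC.map (S.πTruncGE c)) _⟩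

variable [HasDerivedCategory.{w'} (ModuleCat.{u} B)]

lemma isIso_derivedToBaseChange_of_admissible [Module.Flat A I] (hV : boundedAbove _ V)
    (h : E.Admissible V) : IsIso (E.derivedToBaseChange V hV) := by
  have ⟨b, _⟩ := hV
  obtain ⟨S, p, hS, hSb, _, _⟩ :=
    E.exists_projective_of_hkrClass_eq_zero (E.hkrClass_eq_zero_of_admissible h) b
  have : QuasiIso (E.tor₁C.map p) := ⟨fun n => by
    rw [quasiIsoAt_iff_exactAt _ _ (E.admissible_of_projective hS n)]
    exact h n⟩
  have : QuasiIso p := (E.quasiIso_tor₁C_map_iff p).1 inferInstance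
  have naturality := fromLeftDerivedMinus_naturality E.baseChange p ⟨b, hSb⟩ hV
  have := isIso_fromLeftDerivedMinus E.baseChange ⟨b, hSb⟩ hS
  have := isIso_toMinusMap p ⟨b, hSb⟩ hV
  exact IsIso.of_isIso_fac_left naturality

lemma isIso_derivedBaseChange_map_comp [Module.Flat A I] (g : V ⟶ K) (hV : boundedAbove _ V)
    (hK : boundedAbove _ K) (h : E.Admissible V) [QuasiIso (E.baseChangeC.map g)] :
    IsIso (E.derivedBaseChange.map (toMinusMap g hV hK) ≫ E.derivedToBaseChange K hK) := by
  have := E.isIso_derivedToBaseChange_of_admissible hV h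
  have naturality := fromLeftDerivedMinus_naturality E.baseChange g hV hK
  exact naturality ▸ IsIso.comp_isIso' this inferInstance

lemma exists_section_of_isIso {hV : boundedAbove _ V} {hK : boundedAbove _ K}
    (φ : toMinus V hV ⟶ toMinus K hK)
    [IsIso (E.derivedBaseChange.map φ ≫ E.derivedToBaseChange K hK)] :
    ∃ s, s ≫ E.derivedToBaseChange K hK = 𝟙 _ :=
  ⟨inv (E.derivedBaseChange.map φ ≫ E.derivedToBaseChange K hK) ≫ E.derivedBaseChange.map φ, by
    rw [Category.assoc, IsIso.inv_hom_id]⟩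

end Existence

section TwistMul

open ChangeOfRings

lemma exists_retraction_incl :
    ∃ r : B →+ I, (∀ a b, r (E.sect a * b) = a • r b) ∧ ∀ i, r (E.incl i) = i := by
  have decompose (b : B) : ∃ i, E.incl i = b - E.sect (E.proj b) :=
    (E.proj_eq_zero_iff _).1 (by rw [map_sub, E.proj_sect, sub_self])
  choose r hr using decompose
  refine ⟨AddMonoidHom.mk' r fun b c => E.incl_injective ?_, fun a b => E.incl_injective ?_,
    fun i => E.incl_injective ?_⟩
  · simp only [hr, map_add]
    abel
  · change E.incl (r _) = E.incl (a • r b)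
    nth_rw 2 [← E.proj_sect a]
    rw [← E.mul_incl, hr, hr, map_mul, map_mul, E.proj_sect, mul_sub]
  · rw [AddMonoidHom.mk'_apply, hr, (E.proj_eq_zero_iff _).2 ⟨i, rfl⟩, map_zero, sub_zero]

lemma tensorToInduction_tmul (M : ModuleCat.{u} A) (i : I) (m : M) :
    E.tensorToInduction M (i ⊗ₜ[A] m : TensorProduct A I M) =
      E.incl i ⊗ₜ[A, E.sect.toRingHom] m := by
  refine (E.actionHom_toBaseChange (E.induction.obj M) (E.toInduction M m) i).trans ?_
  refine (ModuleCat.ExtendScalars.smul_tmul E.sect.toRingHom _ _ _).trans ?_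
  rw [mul_one]

instance mono_tensorToInduction (M : ModuleCat.{u} A) : Mono (E.tensorToInduction M) := by
  obtain ⟨r, r_smul, r_incl⟩ := E.exists_retraction_incl
  let r' : E.viaSect.obj (ModuleCat.of B B) →ₗ[A] I := { r with map_smul' := r_smul }
  let ρ : E.viaSect.obj (E.induction.obj M) ⟶ (tensorI A I).obj M :=
    ModuleCat.ofHom (X := E.viaSect.obj (E.induction.obj M)) (LinearMap.rTensor M r')
  have retraction : E.tensorToInduction M ≫ ρ = 𝟙 _ :=
    ModuleCat.hom_ext (TensorProduct.ext' fun i m =>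
      (congr_arg ρ (E.tensorToInduction_tmul M i m)).trans
        (congr_arg (· ⊗ₜ[A] m) (r_incl i)))
  exact mono_of_mono_fac retraction

instance mono_mul_induction (M : ModuleCat.{u} A) : Mono (E.mul.app (E.induction.obj M)) := by
  have factor : (tensorI A I).map (E.toBaseChangeInduction M) ≫ E.mul.app (E.induction.obj M) =
    E.tensorToInduction M := rfl
  rw [← IsIso.eq_inv_comp] at factor
  rw [factor]
  infer_instance

open CochainComplex HomComplex

variable {Y : CochainComplex (ModuleCat.{u} A) ℤ} (c : Cocycle Y ((tensorC A I).obj Y) 1)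

instance mono_mulC_twist : Mono (E.mulC (E.twist c)) :=
  HomologicalComplex.mono_of_mono_f _ fun n => E.mono_mul_induction (Y.X n)

end TwistMul

section ViaProj

open CochainComplex HomComplex

lemma exists_quasiIso_viaProjC [HasDerivedCategory.{w} (ModuleCat.{u} A)]
    {P : CochainComplex (ModuleCat.{u} B) ℤ} {Y : CochainComplex (ModuleCat.{u} A) ℤ}
    (φ : E.baseChangeC.obj P ⟶ Y)
    (hφ : IsIso (DerivedCategory.Q.map (E.toBaseChangeC P ≫ φ))) :
    ∃ π : P ⟶ E.viaProjC.obj Y, QuasiIso π := by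
  let π : P ⟶ E.viaProjC.obj Y :=
    (NatTrans.mapHomologicalComplex E.baseChangeAdj.unit (.up ℤ)).app P ≫ E.viaProjC.map φ
  let ι : Y ≅ E.viaSectC.obj (E.viaProjC.obj Y) :=
    HomologicalComplex.Hom.isoOfComponents (fun n => E.viaSectViaProjIso (Y.X n))
  have viaSectC_map_π : E.viaSectC.map π = (E.toBaseChangeC P ≫ φ) ≫ ι.hom := by
    ext n x
    rfl
  rw [DerivedCategory.isIso_Q_map_iff_quasiIso] at hφ
  refine ⟨π, (E.quasiIso_viaSectC_map_iff π).1 ?_⟩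
  rw [viaSectC_map_π]
  infer_instance

instance : PreservesColimitsOfShape (Discrete ℕ) (tensorC A I) :=
  HomologicalComplex.preservesColimitsOfShape_of_eval _ fun n =>
    inferInstanceAs (PreservesColimitsOfShape (Discrete ℕ)
      (HomologicalComplex.eval (ModuleCat.{u} A) (.up ℤ) n ⋙ tensorI A I))

variable {Y : CochainComplex (ModuleCat.{u} A) ℤ} (c : Cocycle Y ((tensorC A I).obj Y) 1)

/-- The identification of `I ⊗ Y` with the source of the multiplication map of a twist. -/
noncomputable abbrev tensorTwistIso : (tensorC A I).obj Y ≅ E.idealTensorC.obj (E.twist c) :=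
  (tensorC A I).mapIso (E.twistIso c)

lemma Q_map_triangleOfSESδ_twist [HasDerivedCategory.{w} (ModuleCat.{u} A)] :
    DerivedCategory.Q.map (E.twistIso c).hom ≫
      DerivedCategory.triangleOfSESδ (E.shortExact_of_mono_mulC (K := E.twist c)) =
    DerivedCategory.Q.map (Cocycle.equivHomShift.symm c ≫ (E.tensorTwistIso c).hom⟦(1 : ℤ)⟧') ≫
      (DerivedCategory.Q.commShiftIso (1 : ℤ)).hom.app _ := by
  have hS := E.shortExact_of_mono_mulC (K := E.twist c)
  have δ_toTwist : δ 0 1 (E.toTwist c) = (c.postcomp (E.tensorTwistIso c).hom).1.comp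
      (Cochain.ofHom (E.mulC (E.twist c))) (add_zero 1) :=
    (E.δ_toTwist c).trans ((congr_arg (fun z => c.1.comp z (add_zero 1))
      (Cochain.ofHom_comp _ _)).trans
        (Cochain.comp_assoc_of_third_is_zero_cochain _ _ _ _).symm)
  have Q_map_δ := ConnectingCocycle.Q_map_triangleOfSESδ hS (ρ := (E.twistIso c).hom)
    (u := E.toTwist c) (γ := c.postcomp (E.tensorTwistIso c).hom) (E.toTwist_toBaseChangeC c)
    δ_toTwist
  rwa [Cocycle.equivHomShift_symm_postcomp] at Q_map_δ

lemma exists_admissible_viaProjC (Y : ℕ → CochainComplex (ModuleCat.{u} A) ℤ)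
    (e : ∀ p, Y (p + 1) ≅ ((tensorC A I).obj (Y p))⟦(1 : ℤ)⟧) (b : ℤ)
    [∀ p, (Y p).IsStrictlyLE b] [HasDerivedCategory.{w} (ModuleCat.{u} A)] :
    ∃ (P : CochainComplex (ModuleCat.{u} B) ℤ) (π : P ⟶ E.viaProjC.obj (Y 0)),
      QuasiIso π ∧ E.Admissible P ∧ P.IsStrictlyLE b ∧ Nonempty (∐ Y ≅ E.baseChangeC.obj P) := by
  let Φ := tensorC A I ⋙ CategoryTheory.shiftFunctor _ (1 : ℤ)
  obtain ⟨σ, hσ⟩ := CoproductTower.exists_splitting Y Φ e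
  let α : ∐ Y ⟶ ((tensorC A I).obj (∐ Y))⟦(1 : ℤ)⟧ := CoproductTower.next Y Φ e
  let c := Cocycle.equivHomShift α
  have hα : Cocycle.equivHomShift.symm c = α := AddEquiv.symm_apply_apply _ _
  have hS := E.shortExact_of_mono_mulC (K := E.twist c)
  have : (∐ Y).IsStrictlyLE b := CoproductTower.isStrictlyLE_coproduct Y b
  let e₂ : DerivedCategory.Q.obj (∐ Y) ≅ DerivedCategory.Q.obj (E.baseChangeC.obj (E.twist c)) :=
    DerivedCategory.Q.mapIso (E.twistIso c)
  let e₃ : DerivedCategory.Q.obj (((tensorC A I).obj (∐ Y))⟦(1 : ℤ)⟧) ≅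
      (DerivedCategory.Q.obj (E.idealTensorC.obj (E.twist c)))⟦(1 : ℤ)⟧ :=
    DerivedCategory.Q.mapIso ((CategoryTheory.shiftFunctor _ (1 : ℤ)).mapIso
      (E.tensorTwistIso c)) ≪≫ (DerivedCategory.Q.commShiftIso (1 : ℤ)).app _
  have comm : e₂.hom ≫ DerivedCategory.triangleOfSESδ hS = DerivedCategory.Q.map α ≫ e₃.hom := by
    refine (E.Q_map_triangleOfSESδ_twist c).trans ?_
    rw [hα, Functor.map_comp, Category.assoc]
    rfl
  have isIso := DistinguishedTriangle.isIso_mor₂_comp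
    (DerivedCategory.triangleOfSES_distinguished hS) (σ.map DerivedCategory.Q) e₂ e₃ comm
  obtain ⟨π, hπ⟩ := E.exists_quasiIso_viaProjC ((E.twistIso c).inv ≫ CoproductTower.fst Y) (by
    rw [← hσ, Functor.map_comp, Functor.map_comp]
    exact isIso)
  exact ⟨E.twist c, π, hπ, E.admissible_of_mono_mulC, inferInstance, ⟨E.twistIso c⟩⟩

end ViaProj

section TensorPower

open CochainComplex

variable (A I)

/-- `I ⊗ I^{⊗ p} ≃ I^{⊗ (p + 1)}`. -/
noncomputable def tensorPowerSucc (p : ℕ) :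
    TensorProduct A I (TensorPower A p I) ≃ₗ[A] TensorPower A (p + 1) I :=
  (TensorProduct.congr (PiTensorProduct.subsingletonEquiv (R := A) (s := fun _ : Fin 1 => I)
    0).symm (LinearEquiv.refl A _)).trans
    (TensorPower.mulEquiv.trans (TensorPower.cast A I (add_comm 1 p)))

variable (N : CochainComplex (ModuleCat.{u} A) ℤ)

/-- `I ⊗ (I^{⊗ p} ⊗ N) ≅ I^{⊗ (p + 1)} ⊗ N`. -/
noncomputable def tensorCTensorPower (p : ℕ) :
    (tensorC A I).obj ((tensorC A (TensorPower A p I)).obj N) ≅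
      (tensorC A (TensorPower A (p + 1) I)).obj N :=
  (NatIso.mapHomologicalComplex ((MonoidalCategory.tensorLeftTensor _ _).symm ≪≫
    (MonoidalCategory.curriedTensor _).mapIso (tensorPowerSucc A I p).toModuleIso :
      MonoidalCategory.tensorLeft (ModuleCat.of A (TensorPower A p I)) ⋙ tensorI A I ≅
        tensorI A (TensorPower A (p + 1) I)) (.up ℤ)).app N

/-- `(I^{⊗ p} ⊗ N)[p]`. -/
noncomputable abbrev tensorTower (p : ℕ) : CochainComplex (ModuleCat.{u} A) ℤ :=
  ((tensorC A (TensorPower A p I)).obj N)⟦(p : ℤ)⟧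

/-- `(I^{⊗ 0} ⊗ N)[0] ≅ N`. -/
noncomputable def tensorTowerZero : tensorTower A I N 0 ≅ N :=
  (CategoryTheory.shiftFunctorZero' _ ((0 : ℕ) : ℤ) Nat.cast_zero).app _ ≪≫
    (NatIso.mapHomologicalComplex ((MonoidalCategory.curriedTensor _).mapIso
      (PiTensorProduct.isEmptyEquiv (R := A) (s := fun _ => I) (Fin 0)).toModuleIso ≪≫
      MonoidalCategory.leftUnitorNatIso _ :
      tensorI A (TensorPower A 0 I) ≅ 𝟭 (ModuleCat.{u} A)) (.up ℤ)).app N ≪≫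
    (Functor.mapHomologicalComplexIdIso _ _).app N

/-- `(I^{⊗ (p + 1)} ⊗ N)[p + 1] ≅ (I ⊗ (I^{⊗ p} ⊗ N)[p])[1]`. -/
noncomputable def tensorTowerSucc (p : ℕ) :
    tensorTower A I N (p + 1) ≅ ((tensorC A I).obj (tensorTower A I N p))⟦(1 : ℤ)⟧ :=
  (CategoryTheory.shiftFunctorAdd' _ (p : ℤ) 1 ((p + 1 : ℕ) : ℤ) (by simp)).app _ ≪≫
    (CategoryTheory.shiftFunctor _ (1 : ℤ)).mapIso
      ((CategoryTheory.shiftFunctor _ (p : ℤ)).mapIso (tensorCTensorPower A I N p).symm ≪≫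
        (((tensorC A I).commShiftIso (p : ℤ)).app _).symm)

instance isStrictlyLE_tensorTower (b : ℤ) [N.IsStrictlyLE b] (p : ℕ) :
    (tensorTower A I N p).IsStrictlyLE b := by
  rw [isStrictlyLE_iff]
  exact fun i hi => (tensorI A (TensorPower A p I)).map_isZero
    (N.isZero_of_isStrictlyLE b (i + p) (by omega))

/-- `(⨁ₚ (I^{⊗ p} ⊗ N)[p])[1] ≅ ⨁ₚ (I^{⊗ p} ⊗ N)[p + 1]` in the derived category. -/
noncomputable def shiftCoproductTensorTowerIso [HasDerivedCategory.{w} (ModuleCat.{u} A)] :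
    (DerivedCategory.Q.obj (∐ tensorTower A I N))⟦(1 : ℤ)⟧ ≅ DerivedCategory.Q.obj
      (∐ fun p : ℕ => ((tensorC A (TensorPower A p I)).obj N)⟦(p : ℤ) + 1⟧) :=
  ((DerivedCategory.Q.commShiftIso (1 : ℤ)).app _).symm ≪≫
    DerivedCategory.Q.mapIso (PreservesCoproduct.iso
      (CategoryTheory.shiftFunctor (CochainComplex (ModuleCat.{u} A) ℤ) (1 : ℤ)) _ ≪≫
        Sigma.mapIso fun p => ((CategoryTheory.shiftFunctorAdd _ (p : ℤ) 1).app _).symm)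

end TensorPower

section Decomposition

open CochainComplex ProjectiveModels

section

variable {S K : CochainComplex (ModuleCat.{u} B) ℤ} (f : S ⟶ K)

instance isStrictlyLE_mulKernel (b : ℤ) [S.IsStrictlyLE b] :
    (E.mulKernel f).IsStrictlyLE b := by
  rw [isStrictlyLE_iff]
  intro i hi
  have : Mono ((E.mulKernelι f).f i) :=
    inferInstanceAs (Mono ((HomologicalComplex.eval _ _ i).map (E.mulKernelι f)))
  exact IsZero.of_mono ((E.mulKernelι f).f i)
    (E.idealTensor.map_isZero (S.isZero_of_isStrictlyLE b i hi))

lemma mulKernel_quotientComplex_shortExact [Mono (E.mulC S)] :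
    (ShortComplex.mk (E.viaProjC.map (E.mulKernelι f) ≫ E.mulBC S)
      (E.quotientComplexπ S (E.mulKernelι f)) (cokernel.condition _)).ShortExact where
  exact := ShortComplex.exact_cokernel _
  mono_f := by
    have (n : ℤ) : Mono ((E.mulKernelι f ≫ E.mulC S).f n) :=
      inferInstanceAs (Mono ((HomologicalComplex.eval _ _ n).map (E.mulKernelι f ≫ E.mulC S)))
    exact HomologicalComplex.mono_of_mono_f _ fun n => (ModuleCat.mono_iff_injective _).2
      ((ModuleCat.mono_iff_injective ((E.mulKernelι f ≫ E.mulC S).f n)).1 inferInstance)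
  epi_g := E.quotientComplexπ_epi S _

end

variable [HasDerivedCategory.{w} (ModuleCat.{u} A)] [HasDerivedCategory.{w'} (ModuleCat.{u} B)]

lemma nonempty_derivedBaseChange_iso_biprod (b : ℤ) {S K P : CochainComplex (ModuleCat.{u} B) ℤ}
    (f : S ⟶ K) (hK : boundedAbove (ModuleCat.{u} B) K) (hS : ∀ n, Projective (S.X n))
    [S.IsStrictlyLE b] [QuasiIso (E.baseChangeC.map f)] [Epi (E.baseChangeC.map f)]
    (hP : ∀ n, Projective (P.X n)) [P.IsStrictlyLE b]
    (g : P ⟶ E.viaProjC.obj (E.mulKernel f)) [QuasiIso g] :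
    Nonempty (E.derivedBaseChange.obj (toMinus K hK) ≅
      DerivedCategory.Q.obj (E.baseChangeC.obj K) ⊞
        (DerivedCategory.Q.obj (E.baseChangeC.obj P))⟦(1 : ℤ)⟧) := by
  have := E.quasiIso_quotientDesc f
  have := E.mono_mulC_of_projective hS
  let u : P ⟶ S := g ≫ E.viaProjC.map (E.mulKernelι f) ≫ E.mulBC S
  obtain ⟨coneIso⟩ :=
    MappingCone.nonempty_Q_mappingCone_iso (E.mulKernel_quotientComplex_shortExact f) g
  obtain ⟨e⟩ := nonempty_leftDerivedMinus_obj_iso E.baseChange (toMinus K hK)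
    ⟨b, isStrictlyLE_mappingCone u b⟩ (projective_mappingCone_X u hP hS)
    ((asIso (DerivedCategory.Q.map (E.quotientDesc f))).symm ≪≫ coneIso.symm)
  have u_comp : u ≫ f = 0 := by
    rw [Category.assoc, E.mulKernelι_mulBC_comp, comp_zero]
  have isIso : IsIso (DerivedCategory.Q.map (E.baseChangeC.map f)) := inferInstance
  have Q_map_u : DerivedCategory.Q.map (E.baseChangeC.map u) = 0 := by
    rw [← cancel_mono (DerivedCategory.Q.map (E.baseChangeC.map f)), ← Functor.map_comp,
      ← Functor.map_comp, u_comp, Functor.map_zero, Functor.map_zero, zero_comp]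
  obtain ⟨split⟩ := MappingCone.nonempty_Q_mappingCone_iso_biprod _ Q_map_u
  exact ⟨e ≪≫ DerivedCategory.Q.mapIso (mappingCone.mapHomologicalComplexIso u E.baseChange) ≪≫
    split ≪≫ biprod.mapIso (asIso (DerivedCategory.Q.map (E.baseChangeC.map f))) (Iso.refl _)⟩

lemma nonempty_derivedBaseChange_iso_biprod_tor₁C [Module.Flat A I]
    {K : CochainComplex (ModuleCat.{u} B) ℤ} (hK : boundedAbove (ModuleCat.{u} B) K)
    (h : E.hkrClass K = 0) :
    Nonempty (E.derivedBaseChange.obj (toMinus K hK) ≅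
      DerivedCategory.Q.obj (E.baseChangeC.obj K) ⊞ (E.derivedBaseChange.obj
        (toMinus (E.viaProjC.obj (E.tor₁C.obj K)) (E.tor₁C_boundedAbove K hK)))⟦(1 : ℤ)⟧) := by
  have ⟨b, _⟩ := hK
  obtain ⟨S, f, hS, _, _, _⟩ := E.exists_projective_of_hkrClass_eq_zero h b
  obtain ⟨τ, _⟩ := E.exists_quasiIso_mulKernel_tor₁C f
  have : QuasiIso (E.viaProjC.map τ) := inferInstance
  have := isStrictlyLE_map E.viaProj (E.mulKernel f) b
  obtain ⟨P, p, _, hP, _, _⟩ := exists_projective_epi (E.viaProjC.obj (E.mulKernel f)) b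
  obtain ⟨e⟩ := E.nonempty_derivedBaseChange_iso_biprod b f hK hS hP p
  obtain ⟨e'⟩ := nonempty_leftDerivedMinus_obj_iso E.baseChange
    (toMinus (E.viaProjC.obj (E.tor₁C.obj K)) (E.tor₁C_boundedAbove K hK)) ⟨b, inferInstance⟩ hP
    (asIso (DerivedCategory.Q.map (p ≫ E.viaProjC.map τ))).symm
  exact ⟨e ≪≫ biprod.mapIso (Iso.refl _) ((CategoryTheory.shiftFunctor _ (1 : ℤ)).mapIso e'.symm)⟩

lemma nonempty_derivedBaseChange_viaProjC_iso [Module.Flat A I]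
    {N : CochainComplex (ModuleCat.{u} A) ℤ} (b : ℤ) [N.IsStrictlyLE b]
    (hN : boundedAbove (ModuleCat.{u} B) (E.viaProjC.obj N)) :
    Nonempty (E.derivedBaseChange.obj (toMinus (E.viaProjC.obj N) hN) ≅
      DerivedCategory.Q.obj (∐ tensorTower A I N)) := by
  obtain ⟨P, π, _, hP, _, ⟨e⟩⟩ :=
    E.exists_admissible_viaProjC (tensorTower A I N) (tensorTowerSucc A I N) b
  have hP' : boundedAbove (ModuleCat.{u} B) P := ⟨b, inferInstance⟩
  have := E.isIso_derivedToBaseChange_of_admissible hP' hP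
  let ζ : P ⟶ E.viaProjC.obj N := π ≫ E.viaProjC.map (tensorTowerZero A I N).hom
  exact ⟨(E.derivedBaseChange.mapIso (asIso (toMinusMap ζ hP' hN))).symm ≪≫
    asIso (E.derivedToBaseChange P hP') ≪≫ DerivedCategory.Q.mapIso e.symm⟩

lemma nonempty_derivedBaseChange_iso_biprod_tensorPowerTor [Module.Flat A I]
    {K : CochainComplex (ModuleCat.{u} B) ℤ} (hK : boundedAbove (ModuleCat.{u} B) K)
    (h : E.hkrClass K = 0) :
    Nonempty (E.derivedBaseChange.obj (toMinus K hK) ≅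
      DerivedCategory.Q.obj (E.baseChangeC.obj K) ⊞
        DerivedCategory.Q.obj (∐ fun p : ℕ => (E.tensorPowerTor K p)⟦(p : ℤ) + 1⟧)) := by
  have ⟨b, _⟩ := hK
  have := isStrictlyLE_map E.tor₁ K b
  obtain ⟨e⟩ := E.nonempty_derivedBaseChange_iso_biprod_tor₁C hK h
  obtain ⟨e'⟩ := E.nonempty_derivedBaseChange_viaProjC_iso b (E.tor₁C_boundedAbove K hK)
  exact ⟨e ≪≫ biprod.mapIso (Iso.refl _) ((CategoryTheory.shiftFunctor _ (1 : ℤ)).mapIso e' ≪≫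
    shiftCoproductTensorTowerIso A I (E.tor₁C.obj K))⟩

end Decomposition

end SplitSqZeroExtension

theorem theorem4p17_general {k : Type v} {A I B : Type u} [Field k]
    [CommRing A] [Algebra k A] [AddCommGroup I] [Module A I] [Module.Flat A I]
    [CommRing B] [Algebra k B] (E : SplitSqZeroExtension k A I B)
    [HasDerivedCategory.{w} (ModuleCat.{u} A)] [HasDerivedCategory.{w'} (ModuleCat.{u} B)]
    (b : ℤ) (K : CochainComplex (ModuleCat.{u} B) ℤ)
    (hK : ProjectiveModels.boundedLE (ModuleCat.{u} B) b K) :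
    List.TFAE
      [ E.hkrClass K = 0,
        ∃ s : DerivedCategory.Q.obj (E.baseChangeC.obj K) ⟶
            E.derivedBaseChange.obj (ProjectiveModels.toMinus K hK.boundedAbove),
          s ≫ E.derivedToBaseChange K hK.boundedAbove = 𝟙 _,
        ∃ (V : CochainComplex (ModuleCat.{u} B) ℤ)
            (hV : ProjectiveModels.boundedLE (ModuleCat.{u} B) b V),
          E.Admissible V ∧
          ∃ φ : ProjectiveModels.toMinus V hV.boundedAbove ⟶
              ProjectiveModels.toMinus K hK.boundedAbove,
            IsIso (E.derivedBaseChange.map φ ≫ E.derivedToBaseChange K hK.boundedAbove),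
        ∃ (V : CochainComplex (ModuleCat.{u} B) ℤ)
            (hV : ProjectiveModels.boundedLE (ModuleCat.{u} B) b V),
          E.Admissible V ∧
          ∃ φ : E.toDerivedAdm V hV.boundedAbove ⟶ E.toDerivedAdm K hK.boundedAbove,
            IsIso (E.baseChangeAdm.map φ),
        ∃ (V : CochainComplex (ModuleCat.{u} B) ℤ)
            (hV : ProjectiveModels.boundedLE (ModuleCat.{u} B) b V),
          E.Admissible V ∧
          ∃ (T : CochainComplex (ModuleCat.{u} A) ℤ) (t : T ⟶ E.idealTensorC.obj V),
            Mono t ∧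
            Nonempty (E.toDerivedAdm K hK.boundedAbove ≅ E.toDerivedAdm (E.quotientComplex V t)
              (E.quotientComplex_boundedAbove V t hV.boundedAbove)) ] ∧
    (E.hkrClass K = 0 →
      Nonempty (E.derivedBaseChange.obj (ProjectiveModels.toMinus K hK.boundedAbove) ≅
        DerivedCategory.Q.obj (E.baseChangeC.obj K) ⊞
          (E.derivedBaseChange.obj (ProjectiveModels.toMinus (E.viaProjC.obj (E.tor₁C.obj K))
            (E.tor₁C_boundedAbove K hK.boundedAbove)))⟦(1 : ℤ)⟧) ∧
      Nonempty (E.derivedBaseChange.obj (ProjectiveModels.toMinus K hK.boundedAbove) ≅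
        DerivedCategory.Q.obj (E.baseChangeC.obj K) ⊞
          DerivedCategory.Q.obj (∐ fun p : ℕ => (E.tensorPowerTor K p)⟦(p : ℤ) + 1⟧))) := by
  refine ⟨?_, fun h => ⟨E.nonempty_derivedBaseChange_iso_biprod_tor₁C hK.boundedAbove h,
    E.nonempty_derivedBaseChange_iso_biprod_tensorPowerTor hK.boundedAbove h⟩⟩
  tfae_have 3 → 2
  | ⟨_, _, _, φ, _⟩ => E.exists_section_of_isIso φ
  tfae_have 2 → 1
  | ⟨s, hs⟩ => E.hkrClass_eq_zero_of_section K hK.boundedAbove s hs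
  tfae_have 4 → 1
  | ⟨_, hV, hV', φ, _⟩ => E.hkrClass_eq_zero_of_adm hV.boundedAbove hK.boundedAbove hV' φ
  tfae_have 5 → 4
  | ⟨V, hV, hV', _, _, _, ⟨e⟩⟩ =>
    ⟨V, hV, hV', E.exists_adm_of_iso_quotientComplex hV.boundedAbove hK.boundedAbove e⟩
  tfae_have 1 → 3 := fun h =>
    have ⟨V, g, hV, hV', _, _⟩ := E.exists_admissible_of_hkrClass_eq_zero hK h
    ⟨V, hV, hV', ProjectiveModels.toMinusMap g hV.boundedAbove hK.boundedAbove,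
      E.isIso_derivedBaseChange_map_comp g hV.boundedAbove hK.boundedAbove hV'⟩
  tfae_have 1 → 5 := fun h =>
    have ⟨V, g, hV, hV', _, _⟩ := E.exists_admissible_of_hkrClass_eq_zero hK h
    ⟨V, hV, hV', E.mulKernel g, E.mulKernelι g, inferInstance,
      E.nonempty_toDerivedAdm_iso_quotientComplex g hV.boundedAbove hK.boundedAbove⟩
  tfae_finish

theorem theorem4p17 {k : Type v} {A I B : Type u} [Field k] [CharZero k]
    [CommRing A] [Algebra k A] [AddCommGroup I] [Module A I] [Module.Free A I] [Module.Finite A I]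
    [CommRing B] [Algebra k B] (E : SplitSqZeroExtension k A I B)
    [HasDerivedCategory.{w} (ModuleCat.{u} A)] [HasDerivedCategory.{w'} (ModuleCat.{u} B)]
    (b : ℤ) (K : CochainComplex (ModuleCat.{u} B) ℤ) (hK : ProjectiveModels.boundedLE (ModuleCat.{u} B) b K) :
    List.TFAE
      [ E.hkrClass K = 0,
        ∃ s : DerivedCategory.Q.obj (E.baseChangeC.obj K) ⟶
            E.derivedBaseChange.obj (ProjectiveModels.toMinus K hK.boundedAbove),
          s ≫ E.derivedToBaseChange K hK.boundedAbove = 𝟙 _,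
        ∃ (V : CochainComplex (ModuleCat.{u} B) ℤ) (hV : ProjectiveModels.boundedLE (ModuleCat.{u} B) b V),
          E.Admissible V ∧
          ∃ φ : ProjectiveModels.toMinus V hV.boundedAbove ⟶
              ProjectiveModels.toMinus K hK.boundedAbove,
            IsIso (E.derivedBaseChange.map φ ≫ E.derivedToBaseChange K hK.boundedAbove),
        ∃ (V : CochainComplex (ModuleCat.{u} B) ℤ) (hV : ProjectiveModels.boundedLE (ModuleCat.{u} B) b V),
          E.Admissible V ∧
          ∃ φ : E.toDerivedAdm V hV.boundedAbove ⟶ E.toDerivedAdm K hK.boundedAbove,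
            IsIso (E.baseChangeAdm.map φ),
        ∃ (V : CochainComplex (ModuleCat.{u} B) ℤ) (hV : ProjectiveModels.boundedLE (ModuleCat.{u} B) b V),
          E.Admissible V ∧
          ∃ (T : CochainComplex (ModuleCat.{u} A) ℤ) (t : T ⟶ E.idealTensorC.obj V),
            Mono t ∧
            Nonempty (E.toDerivedAdm K hK.boundedAbove ≅ E.toDerivedAdm (E.quotientComplex V t)
              (E.quotientComplex_boundedAbove V t hV.boundedAbove)) ] ∧
    (E.hkrClass K = 0 →
      Nonempty (E.derivedBaseChange.obj (ProjectiveModels.toMinus K hK.boundedAbove) ≅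
        DerivedCategory.Q.obj (E.baseChangeC.obj K) ⊞
          (E.derivedBaseChange.obj (ProjectiveModels.toMinus (E.viaProjC.obj (E.tor₁C.obj K))
            (E.tor₁C_boundedAbove K hK.boundedAbove)))⟦(1 : ℤ)⟧) ∧
      Nonempty (E.derivedBaseChange.obj (ProjectiveModels.toMinus K hK.boundedAbove) ≅
        DerivedCategory.Q.obj (E.baseChangeC.obj K) ⊞
          DerivedCategory.Q.obj (∐ fun p : ℕ => (E.tensorPowerTor K p)⟦(p : ℤ) + 1⟧))) :=
  theorem4p17_general E b K hK
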